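/- Let $\Gamma$ be a connected compact metric graph (finitely many vertices and edges, at least one edge, no loops or multiple edges), where each edge $e$ is identified with an interval $[0,\ell_e]$, $0<\ell_e<\infty$, oriented from its initial vertex (coordinate $0$) to its terminal vertex (coordinate $\ell_e$). Functions $u$ on $\Gamma$ are families $[u]_e$ of functions on $(0,\ell_e)$, $\int_\Gamma u=\sum_e\int_0^{\ell_e}[u]_e$, $\ell(D)=\int_\Gamma\chi_D$ is the length of $D\subset\Gamma$, and $BV(\Gamma)$, $L^p(\Gamma)$, $W^{1,2}(\Gamma)$ are defined edgewise, with no condition at the vertices. Let $X_K(\Gamma)$ be the set of $\mathbf z\in W^{1,2}(\Gamma)$ such that at every vertex $\mathbf v$ the sum of $[\mathbf z]_e(\ell_e)$ over the edges $e$ ending at $\mathbf v$ equals the sum of $[\mathbf z]_e(0)$ over the edges starting at $\mathbf v$. For $u\in BV(\Gamma)$ put $$TV_\Gamma(u)=\sup\Big\{\Big|\int_\Gamma u\,\mathbf z'\Big| : \mathbf z\in X_K(\Gamma),\ \|\mathbf z\|_{L^\infty(\Gamma)}\le 1\Big\},$$ and let $\mathcal F_\Gamma:L^2(\Gamma)\to[0,+\infty]$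 be $TV_\Gamma$ on $BV(\Gamma)$ and $+\infty$ elsewhere; $-\Delta_1^\Gamma$ is its subdifferential $\partial\mathcal F_\Gamma$ in $L^2(\Gamma)$. Call $D\subset\Gamma$ of finite perimeter if $\chi_D\in BV(\Gamma)$, with $\mathrm{Per}_\Gamma(D)=TV_\Gamma(\chi_D)$. The Cheeger constant is $$h(\Gamma)=\inf\Big\{\frac{\mathrm{Per}_\Gamma(D)}{\min\{\ell(D),\ell(\Gamma\setminus D)\}} : D\subset\Gamma \text{ of finite perimeter},\ 0<\ell(D)<\ell(\Gamma)\Big\},$$ and $D$ (of finite perimeter) is a Cheeger cut if $0<\ell(D)\le\frac12\ell(\Gamma)$ and $h(\Gamma)=\mathrm{Per}_\Gamma(D)/\ell(D)$. A pair $(\lambda,u)\in\mathbb R\times BV(\Gamma)$ is a $\Gamma$-eigenpair of $-\Delta_1^\Gamma$, and $\lambda$ a $\Gamma$-eigenvalue, if $\|u\|_{L^1(\Gamma)}=1$ and $\lambda\xi\in\partial\mathcal F_\Gamma(u)$ for some $\xi$ with $\xi=1$ on $\{u>0\}$, $\xi=-1$ on $\{u<0\}$ and $\xi\in[-1,1]$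 on $\{u=0\}$. Finally let $\Pi(\Gamma)$ be the set of $u\in BV(\Gamma)$ with $\|u\|_{L^1(\Gamma)}=1$, $\ell(\{u<0\})\le\frac12\ell(\Gamma)$ and $\ell(\{u>0\})\le\frac12\ell(\Gamma)$, and write $E_t(u)=\{x\in\Gamma: u(x)>t\}$. Theorem. (1) $h(\Gamma)=\inf\{\lambda\ne 0:\lambda \text{ is a } \Gamma\text{-eigenvalue of } -\Delta_1^\Gamma\}$. (2) $h(\Gamma)$ is itself a nonzero $\Gamma$-eigenvalue of $-\Delta_1^\Gamma$, hence the smallest one. (3) Let $u$ be a minimizer of $TV_\Gamma$ over $\Pi(\Gamma)$. If $\ell(\{u>0\})>0$, there is $t\ge 0$ such that $E_t(u)$ is a Cheeger cut of $\Gamma$ and $$\Big(h(\Gamma),\ \tfrac{1}{\ell(E_t(u))}\chi_{E_t(u)}\Big)$$ is a $\Gamma$-eigenpair of $-\Delta_1^\Gamma$. If $\ell(\{u<0\})>0$, the same holds with $u$ replaced by $-u$. (At least one of the two cases occurs, since $\|u\|_{L^1(\Gamma)}=1$.) -/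

import Mathlib

open MeasureTheory Set
open scoped ContDiff

noncomputable section

/-- Smooth test functions with compact support in the open interval `(a, b)`. -/
def IsTestFunction (a b : ℝ) (φ : ℝ → ℝ) : Prop :=
  ContDiff ℝ ∞ φ ∧ HasCompactSupport φ ∧ tsupport φ ⊆ Ioo a b

/-- `w` is the weak (distributional) derivative of `z` on `(a, b)`. -/
def HasWeakDerivOn (a b : ℝ) (z w : ℝ → ℝ) : Prop :=
  ∀ φ : ℝ → ℝ, IsTestFunction a b φ →
    ∫ x in Ioo a b, z x * deriv φ x = - ∫ x in Ioo a b, w x * φ x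

/-- `u ∈ BV(a, b)`: `u ∈ L¹(a, b)` and the distributional derivative of `u` is a signed
measure of finite total variation, written as a difference `μ - ν` of two finite measures. -/
def IsBVOn (a b : ℝ) (u : ℝ → ℝ) : Prop :=
  IntegrableOn u (Ioo a b) ∧
    ∃ μ ν : Measure ℝ, IsFiniteMeasure μ ∧ IsFiniteMeasure ν ∧
      ∀ φ : ℝ → ℝ, IsTestFunction a b φ →
        ∫ x in Ioo a b, u x * deriv φ x = - ((∫ x, φ x ∂μ) - ∫ x, φ x ∂ν)

/-- The multivalued sign. -/
def signSet (a : ℝ) : Set ℝ :=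
  if 0 < a then {1} else if a < 0 then {-1} else Icc (-1) 1

/-- A connected compact metric graph with vertex set `V` and edge set `E` (both are taken finite
below), without loops and multiple edges.  The edge `e` runs from `ini e` to `ter e` and is
identified with `[0, len e]`. -/
structure MetricGraph (V E : Type*) where
  ini : E → V
  ter : E → V
  len : E → ℝ
  len_pos : ∀ e, 0 < len e
  no_loops : ∀ e, ini e ≠ ter e
  no_multiple_edges : ∀ e e', s(ini e, ter e) = s(ini e', ter e') → e = e'
  connected : (SimpleGraph.fromRel fun v w => ∃ e, ini e = v ∧ ter e = w).Connected

namespace MetricGraph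

/-! A function on the graph is a family `u : E → ℝ → ℝ`, where `u e` is the function on the
edge `e` in its coordinate; only the values on `(0, len e)` matter (and, for continuous
representatives, on `[0, len e]`).  Likewise a subset is a family `D : E → Set ℝ`, `D e` being the
part in the edge `e`; vertices have length zero and are not recorded. -/

variable {V E : Type*} [Fintype V] [Fintype E] (Γ : MetricGraph V E)

/-- The open edge, in its coordinate. -/
def edge (e : E) : Set ℝ := Ioo 0 (Γ.len e)

/-- `∫_Γ u`. -/
def integral (u : E → ℝ → ℝ) : ℝ := ∑ e, ∫ x in Γ.edge e, u e x

/-- The length `ℓ(D)` of a subset `D`. -/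
def length (D : E → Set ℝ) : ℝ := ∑ e, volume.real (D e ∩ Γ.edge e)

/-- The length `ℓ(Γ)`. -/
def totalLength : ℝ := ∑ e, Γ.len e

/-- The complement `Γ \ D`. -/
def compl (D : E → Set ℝ) : E → Set ℝ := fun e => Γ.edge e \ D e

/-- The characteristic function of `D`. -/
def chi (D : E → Set ℝ) : E → ℝ → ℝ := fun e => (D e).indicator 1

/-- The superlevel set `E_t(u) = {u > t}`. -/
def superlevel (u : E → ℝ → ℝ) (t : ℝ) : E → Set ℝ := fun e => {x ∈ Γ.edge e | t < u e x}

/-- The sublevel set `{u < t}`. -/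
def sublevel (u : E → ℝ → ℝ) (t : ℝ) : E → Set ℝ := fun e => {x ∈ Γ.edge e | u e x < t}

/-- `u ∈ L²(Γ)`. -/
def IsL2 (u : E → ℝ → ℝ) : Prop := ∀ e, MemLp (u e) 2 (volume.restrict (Γ.edge e))

/-- `‖u‖_{L¹(Γ)}`. -/
def norm1 (u : E → ℝ → ℝ) : ℝ := Γ.integral fun e x => |u e x|

/-- `u ∈ BV(Γ)`. -/
def IsBV (u : E → ℝ → ℝ) : Prop := ∀ e, IsBVOn 0 (Γ.len e) (u e)

/-- `z ∈ W^{1,2}(Γ)` with weak derivative `z' = dz`; `z` is the representative that is continuous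
on every closed edge (continuity across vertices is not required). -/
def IsW12 (z dz : E → ℝ → ℝ) : Prop :=
  Γ.IsL2 z ∧ Γ.IsL2 dz ∧ (∀ e, HasWeakDerivOn 0 (Γ.len e) (z e) (dz e)) ∧
    ∀ e, ContinuousOn (z e) (Icc 0 (Γ.len e))

open Classical in
/-- The value `[z]_e(v)` at a vertex `v` of the edge `e`, with the sign of the outward normal. -/
def vertexValue (z : E → ℝ → ℝ) (e : E) (v : V) : ℝ :=
  if v = Γ.ter e then z e (Γ.len e) else - z e 0

open Classical in
/-- `z ∈ X_K(Γ)`, with `z' = dz`: `z ∈ W^{1,2}(Γ)` satisfies the Kirchhoff condition at every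
vertex. -/
def IsXK (z dz : E → ℝ → ℝ) : Prop :=
  Γ.IsW12 z dz ∧
    ∀ v : V, ∑ e with (v = Γ.ini e ∨ v = Γ.ter e), Γ.vertexValue z e v = 0

/-- The total variation `TV_Γ(u)`, used only for `u ∈ BV(Γ)`, where the supremum is finite. -/
def TV (u : E → ℝ → ℝ) : ℝ :=
  sSup {r | ∃ z dz : E → ℝ → ℝ, Γ.IsXK z dz ∧
    (∀ e, ∀ᵐ x ∂(volume.restrict (Γ.edge e)), |z e x| ≤ 1) ∧
    r = |Γ.integral fun e x => u e x * dz e x|}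

/-- `D` is a set of finite perimeter. -/
def FinitePerimeter (D : E → Set ℝ) : Prop := Γ.IsBV (chi D)

/-- The perimeter `Per_Γ(D)`. -/
def Per (D : E → Set ℝ) : ℝ := Γ.TV (chi D)

open Classical in
/-- The energy functional `F_Γ` on `L²(Γ)`. -/
def energy (u : E → ℝ → ℝ) : EReal := if Γ.IsBV u then ((Γ.TV u : ℝ) : EReal) else ⊤

/-- `v ∈ ∂F_Γ(u)`, the subdifferential in `L²(Γ)`; equivalently `v ∈ -Δ₁ u`. -/
def IsSubgradient (u v : E → ℝ → ℝ) : Prop :=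
  Γ.IsL2 u ∧ Γ.IsL2 v ∧ ∀ w : E → ℝ → ℝ, Γ.IsL2 w →
    Γ.energy u + ((Γ.integral fun e x => v e x * (w e x - u e x) : ℝ) : EReal) ≤ Γ.energy w

/-- `(lam, u)` is an eigenpair of the operator `-Δ₁`. -/
def IsEigenpair (lam : ℝ) (u : E → ℝ → ℝ) : Prop :=
  Γ.IsBV u ∧ Γ.norm1 u = 1 ∧
    ∃ ξ : E → ℝ → ℝ, (∀ e, ∀ x ∈ Γ.edge e, ξ e x ∈ signSet (u e x)) ∧
      Γ.IsSubgradient u fun e x => lam * ξ e x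

/-- `lam` is an eigenvalue of `-Δ₁`. -/
def IsEigenvalue (lam : ℝ) : Prop := ∃ u, Γ.IsEigenpair lam u

/-- The Cheeger constant `h(Γ)`.  Sets that are not of finite perimeter have infinite perimeter
and do not compete. -/
def cheeger : ℝ :=
  sInf {r | ∃ D : E → Set ℝ, Γ.FinitePerimeter D ∧ 0 < Γ.length D ∧ Γ.length D < Γ.totalLength ∧
    r = Γ.Per D / min (Γ.length D) (Γ.length (Γ.compl D))}

/-- `(D, Γ \ D)` is a Cheeger cut. -/
def IsCheegerCut (D : E → Set ℝ) : Prop :=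
  Γ.FinitePerimeter D ∧ 0 < Γ.length D ∧ Γ.length D ≤ Γ.totalLength / 2 ∧
    Γ.cheeger = Γ.Per D / Γ.length D

/-- `m` is a median of `u`. -/
def IsMedian (u : E → ℝ → ℝ) (m : ℝ) : Prop :=
  Γ.length (Γ.sublevel u m) ≤ Γ.totalLength / 2 ∧
    Γ.length (Γ.superlevel u m) ≤ Γ.totalLength / 2

/-- The class `Π(Γ)` of competitors. -/
def competitors : Set (E → ℝ → ℝ) := {u | Γ.IsBV u ∧ Γ.norm1 u = 1 ∧ Γ.IsMedian u 0}

/-- `u` minimizes `TV_Γ` over `Π(Γ)`. -/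
def IsMinimizer (u : E → ℝ → ℝ) : Prop :=
  u ∈ Γ.competitors ∧ ∀ w ∈ Γ.competitors, Γ.TV u ≤ Γ.TV w

end MetricGraph

end

/-!
The proof is a duality argument. An *admissible* field is a Kirchhoff field `z` with `|z| ≤ 1`. By a
max-flow min-cut theorem on the metric graph (Hoffman's circulation theorem for the values at the
vertices), a function `f` with vanishing integral is the derivative of an admissible field as soon
as `∫_A f` is at most the number of boundary points of `A`, for the sets `A` that meet every edge in
an interval issuing from one of its ends and for the arcs. The competitors of this kind in the
Cheeger problem form a compact family, so there is an optimal one among them; writing `h` for its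
quotient, every *balanced* `ξ`, that is `|ξ| ≤ 1` and `∫ ξ = 0`, has an admissible field with
`z' = h ξ`. If `0` is a median of `u`, some sign `ξ` of `u` is balanced and the field yields
`h ‖u‖₁ = ∫ u z' ≤ TV(u)`. For characteristic functions this identifies `h` as the Cheeger constant,
and for eigenfunctions it gives the bound below on the eigenvalues. If moreover `TV(u) ≤ h ‖u‖₁`,
then `h ξ = z'` is a subgradient at `u`; this applies to the normalized characteristic function of a
Cheeger cut.

If `u` is a minimizer, the field `z` maximizes `∫ u w'` among admissible fields `w`. Moving flux of
`z` around where `|z| < 1` shows that `u` is constant there. Where `u > 0` one has `z' = h > 0`,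
hence `|z| < 1` almost everywhere, so that in each edge `{u > 0}` is a finite union of intervals
which `z` traverses from `-1` to `1`, except at the ends of the edge. At a vertex, exchanging flux
between two incident edges shows that if `{u > 0}` reaches it through one of them with outward flux
less than `1`, then it reaches it through every edge with outward flux greater than `-1`. Thus `z`
also maximizes the integral of `w'` over `{u > 0}`, so this set has perimeter `h` times its length.
-/

noncomputable section

section Interval

variable {a b : ℝ}

theorem integral_setIntegral_Iic_mul {m n : Measure ℝ} [SFinite m] [SFinite n] {f g : ℝ → ℝ}
    (hg : Integrable g m) (hf : Integrable f n) :
    ∫ x, (∫ s in Iic x, g s ∂m) * f x ∂n = ∫ s, g s * (∫ x in Ici s, f x ∂n) ∂m := by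
  have hT : MeasurableSet {p : ℝ × ℝ | p.2 ≤ p.1} := measurableSet_le measurable_snd measurable_fst
  have hswap := integral_integral_swap
    (f := fun x s => {p : ℝ × ℝ | p.2 ≤ p.1}.indicator (fun p => f p.1 * g p.2) (x, s))
    ((hf.mul_prod hg).indicator hT)
  convert hswap using 2 with x s
  · ext x
    rw [← integral_indicator measurableSet_Iic, mul_comm, ← integral_const_mul]
    congr 1 with s
    by_cases hs : s ≤ x <;> simp [indicator, hs]
  · ext s
    rw [← integral_indicator measurableSet_Ici, ← integral_const_mul]
    congr 1 with x
    by_cases hs : s ≤ x <;> simp [indicator, hs, mul_comm]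

theorem setIntegral_Ici_restrict_Ioo {s : ℝ} (f : ℝ → ℝ) (hs : s ∈ Icc a b) :
    ∫ x in Ici s, f x ∂(volume.restrict (Ioo a b)) = ∫ x in s..b, f x := by
  rw [restrict_Ioo_eq_restrict_Icc, Measure.restrict_restrict measurableSet_Ici,
    ← Ici_inter_Iic, ← inter_assoc, Ici_inter_Ici, sup_of_le_left hs.1, Ici_inter_Iic,
    intervalIntegral.integral_of_le hs.2, integral_Icc_eq_integral_Ioc]

theorem setIntegral_Iic_restrict_Ioo {x : ℝ} (f : ℝ → ℝ) (hx : x ∈ Icc a b) :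
    ∫ s in Iic x, f s ∂(volume.restrict (Ioo a b)) = ∫ s in a..x, f s := by
  rw [restrict_Ioo_eq_restrict_Icc, Measure.restrict_restrict measurableSet_Iic,
    ← Ici_inter_Iic, inter_left_comm, Iic_inter_Iic, inf_of_le_left hx.2, Ici_inter_Iic,
    intervalIntegral.integral_of_le hx.1, integral_Icc_eq_integral_Ioc]

theorem continuousOn_primitive_of_integrableOn_Ioo (hab : a ≤ b) {w : ℝ → ℝ}
    (hw : IntegrableOn w (Ioo a b)) : ContinuousOn (fun x => ∫ s in a..x, w s) (Icc a b) := by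
  rw [← uIcc_of_le hab]
  refine intervalIntegral.continuousOn_primitive_interval ?_
  rwa [uIcc_of_le hab, integrableOn_Icc_iff_integrableOn_Ioo]

theorem intervalIntegrable_of_integrableOn_Ioo {w : ℝ → ℝ} (hw : IntegrableOn w (Ioo a b))
    {x y : ℝ} (hx : x ∈ Icc a b) (hy : y ∈ Icc a b) : IntervalIntegrable w volume x y :=
  (((integrableOn_Icc_iff_integrableOn_Ioo).2 hw).mono_set
    (uIcc_subset_Icc hx hy)).intervalIntegrable

theorem setIntegral_Ioo_eq_intervalIntegral (hab : a ≤ b) (f : ℝ → ℝ) :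
    ∫ x in Ioo a b, f x = ∫ x in a..b, f x := by
  rw [intervalIntegral.integral_of_le hab, integral_Ioc_eq_integral_Ioo]

namespace IsTestFunction

variable {φ : ℝ → ℝ}

theorem apply_eq_zero (h : IsTestFunction a b φ) {x : ℝ} (hx : x ∉ Ioo a b) : φ x = 0 :=
  image_eq_zero_of_notMem_tsupport fun h' => hx (h.2.2 h')

theorem continuous_deriv (h : IsTestFunction a b φ) : Continuous (deriv φ) :=
  h.1.continuous_deriv (by simp)

theorem integrable_deriv (h : IsTestFunction a b φ) : Integrable (deriv φ) :=
  h.continuous_deriv.integrable_of_hasCompactSupport h.2.1.deriv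

theorem integral_deriv (h : IsTestFunction a b φ) (s : ℝ) : ∫ x in s..b, deriv φ x = - φ s := by
  rw [intervalIntegral.integral_deriv_eq_sub (fun x _ => h.1.differentiable (by simp) x)
    h.integrable_deriv.intervalIntegrable, h.apply_eq_zero right_notMem_Ioo, zero_sub]

theorem integrableOn_mul (h : IsTestFunction a b φ) {f : ℝ → ℝ} (hf : IntegrableOn f (Ioo a b)) :
    IntegrableOn (fun x => f x * φ x) (Ioo a b) := by
  obtain ⟨C, hC⟩ := h.2.1.exists_bound_of_continuous h.1.continuous
  exact hf.mul_bdd h.1.continuous.aestronglyMeasurable.restrict (Filter.Eventually.of_forall hC)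

theorem integrableOn_mul_deriv (h : IsTestFunction a b φ) {f : ℝ → ℝ}
    (hf : IntegrableOn f (Ioo a b)) : IntegrableOn (fun x => f x * deriv φ x) (Ioo a b) := by
  obtain ⟨C, hC⟩ := h.2.1.deriv.exists_bound_of_continuous h.continuous_deriv
  exact hf.mul_bdd h.continuous_deriv.aestronglyMeasurable.restrict (Filter.Eventually.of_forall hC)

theorem setIntegral_deriv (h : IsTestFunction a b φ) (hab : a ≤ b) :
    ∫ x in Ioo a b, deriv φ x = 0 := by
  rw [setIntegral_Ioo_eq_intervalIntegral hab, h.integral_deriv, h.apply_eq_zero left_notMem_Ioo,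
    neg_zero]

theorem integral_Iic_mul_deriv (h : IsTestFunction a b φ) {m : Measure ℝ} [SFinite m] {g : ℝ → ℝ}
    (hg : Integrable g m) (hm : ∀ᵐ s ∂m, s ∈ Ioo a b) :
    ∫ x in Ioo a b, (∫ s in Iic x, g s ∂m) * deriv φ x = - ∫ s, g s * φ s ∂m := by
  rw [integral_setIntegral_Iic_mul hg h.integrable_deriv.integrableOn, ← integral_neg]
  refine integral_congr_ae ?_
  filter_upwards [hm] with s hs
  rw [setIntegral_Ici_restrict_Ioo _ (Ioo_subset_Icc_self hs), h.integral_deriv, mul_neg]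

theorem sub_const_mul {ψ : ℝ → ℝ} (hφ : IsTestFunction a b φ) (hψ : IsTestFunction a b ψ)
    (c : ℝ) : IsTestFunction a b fun x => φ x - c * ψ x := by
  have hsupp : tsupport (fun x => φ x - c * ψ x) ⊆ tsupport φ ∪ tsupport ψ := by
    refine closure_minimal (fun x hx => ?_) ((isClosed_tsupport φ).union (isClosed_tsupport ψ))
    contrapose! hx
    rw [mem_union, not_or] at hx
    simp [image_eq_zero_of_notMem_tsupport hx.1, image_eq_zero_of_notMem_tsupport hx.2]
  exact ⟨hφ.1.sub (contDiff_const.mul hψ.1),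
    (hφ.2.1.union hψ.2.1).of_isClosed_subset (isClosed_tsupport _) hsupp,
    hsupp.trans (union_subset hφ.2.2 hψ.2.2)⟩

theorem exists_deriv_eq (h : IsTestFunction a b φ) (hab : a < b) (h0 : ∫ x, φ x = 0) :
    ∃ Φ, IsTestFunction a b Φ ∧ deriv Φ = φ := by
  have hderiv : ∀ x, HasDerivAt (fun x => ∫ s in a..x, φ s) (φ x) x := fun x =>
    h.1.continuous.integral_hasStrictDerivAt a x |>.hasDerivAt
  have hK : IsCompact (insert ((a + b) / 2) (tsupport φ)) := h.2.1.insert _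
  have hKab : insert ((a + b) / 2) (tsupport φ) ⊆ Ioo a b :=
    insert_subset ⟨by linarith, by linarith⟩ h.2.2
  obtain ⟨c, hcK, hc⟩ := hK.exists_isLeast (insert_nonempty _ _)
  obtain ⟨d, hdK, hd⟩ := hK.exists_isGreatest (insert_nonempty _ _)
  have hφ : ∀ x, x ∉ Icc c d → φ x = 0 := fun x hx =>
    image_eq_zero_of_notMem_tsupport fun hx' =>
      hx ⟨hc (mem_insert_of_mem _ hx'), hd (mem_insert_of_mem _ hx')⟩
  have hsupp : Function.support (fun x => ∫ s in a..x, φ s) ⊆ Icc c d := by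
    intro x hx
    by_contra hxcd
    refine hx ?_
    rcases lt_or_ge x c with hxc | hcx
    · refine intervalIntegral.integral_zero_ae (Filter.Eventually.of_forall fun s hs => ?_)
      exact hφ s fun hs' =>
        absurd (hs.2.trans_lt (max_lt (hKab hcK).1 hxc)) (not_lt.2 hs'.1)
    · have hdx : d < x := lt_of_not_ge fun hxd => hxcd ⟨hcx, hxd⟩
      change ∫ s in a..x, φ s = 0
      rw [intervalIntegral.integral_eq_integral_of_support_subset, h0]
      intro s hs
      have hs' : s ∈ Icc c d := by_contra fun hs' => hs (hφ s hs')
      exact ⟨(hKab hcK).1.trans_le hs'.1, hs'.2.trans hdx.le⟩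
  have htsupp := closure_minimal hsupp isClosed_Icc
  refine ⟨_, ⟨?_, isCompact_Icc.of_isClosed_subset (isClosed_tsupport _) htsupp,
    htsupp.trans fun x hx => ⟨(hKab hcK).1.trans_le hx.1, hx.2.trans_lt (hKab hdK).2⟩⟩,
    funext fun x => (hderiv x).deriv⟩
  rw [contDiff_infty_iff_deriv, funext fun x => (hderiv x).deriv]
  exact ⟨fun x => (hderiv x).differentiableAt, h.1⟩

end IsTestFunction

theorem exists_isTestFunction_integral_eq_one (hab : a < b) :
    ∃ η, IsTestFunction a b η ∧ ∫ x, η x = 1 := by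
  let β : ContDiffBump ((a + b) / 2) := ⟨(b - a) / 8, (b - a) / 4, by linarith, by linarith⟩
  refine ⟨β.normed volume, ⟨β.contDiff_normed, β.hasCompactSupport_normed, ?_⟩, β.integral_normed⟩
  rw [β.tsupport_normed_eq, Real.closedBall_eq_Icc]
  exact Icc_subset_Ioo (by simp only [β]; linarith) (by simp only [β]; linarith)

/-- The du Bois-Reymond lemma. -/
theorem ae_eq_const_of_integral_mul_deriv_eq_zero (hab : a < b) {f : ℝ → ℝ}
    (hf : IntegrableOn f (Ioo a b))
    (h : ∀ φ, IsTestFunction a b φ → ∫ x in Ioo a b, f x * deriv φ x = 0) :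
    ∃ c, ∀ᵐ x ∂(volume.restrict (Ioo a b)), f x = c := by
  obtain ⟨η, hη, hη1⟩ := exists_isTestFunction_integral_eq_one hab
  set c := ∫ x in Ioo a b, f x * η x
  have horth : ∀ ψ, IsTestFunction a b ψ → ∫ x in Ioo a b, (f x - c) * ψ x = 0 := by
    intro ψ hψ
    have hψi : Integrable ψ := hψ.1.continuous.integrable_of_hasCompactSupport hψ.2.1
    have hηi : Integrable η := hη.1.continuous.integrable_of_hasCompactSupport hη.2.1
    obtain ⟨Φ, hΦ, hderiv⟩ := (hψ.sub_const_mul hη (∫ x, ψ x)).exists_deriv_eq hab (by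
      rw [integral_sub hψi (hηi.const_mul _), integral_const_mul, hη1, mul_one, sub_self])
    have hfΦ := h Φ hΦ
    have hψ_Ioo : ∫ x in Ioo a b, ψ x = ∫ x, ψ x :=
      setIntegral_eq_integral_of_forall_compl_eq_zero fun x hx => hψ.apply_eq_zero hx
    simp only [hderiv, mul_sub, mul_left_comm _ (∫ x, ψ x)] at hfΦ
    rw [integral_sub (hψ.integrableOn_mul hf) ((hη.integrableOn_mul hf).const_mul _),
      integral_const_mul] at hfΦ
    simp only [sub_mul]
    rw [integral_sub (hψ.integrableOn_mul hf) (hψi.integrableOn.const_mul c), integral_const_mul,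
      hψ_Ioo, mul_comm c, hfΦ]
  have hfc : IntegrableOn (fun x => f x - c) (Ioo a b) := hf.sub (integrableOn_const (by simp))
  have hzero := isOpen_Ioo.ae_eq_zero_of_integral_contDiff_smul_eq_zero (μ := volume)
    hfc.locallyIntegrableOn fun ψ hψ hψc hψs => by
      rw [← horth ψ ⟨hψ, hψc, hψs⟩, setIntegral_eq_integral_of_forall_compl_eq_zero fun x hx => by
        rw [IsTestFunction.apply_eq_zero ⟨hψ, hψc, hψs⟩ hx, mul_zero]]
      simp only [smul_eq_mul, mul_comm]
  refine ⟨c, (ae_restrict_iff' measurableSet_Ioo).2 ?_⟩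
  filter_upwards [hzero] with x hx hxab using sub_eq_zero.1 (hx hxab)

theorem hasWeakDerivOn_primitive (hab : a ≤ b) {w z : ℝ → ℝ} {c : ℝ}
    (hw : IntegrableOn w (Ioo a b)) (hz : ∀ x ∈ Ioo a b, z x = c + ∫ s in a..x, w s) :
    HasWeakDerivOn a b z w := by
  intro φ hφ
  have hprim : IntegrableOn (fun x => ∫ s in a..x, w s) (Ioo a b) :=
    (continuousOn_primitive_of_integrableOn_Ioo hab hw).integrableOn_Icc.mono_set
      Ioo_subset_Icc_self
  calc ∫ x in Ioo a b, z x * deriv φ x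
      = ∫ x in Ioo a b, (c * deriv φ x + (∫ s in a..x, w s) * deriv φ x) :=
        setIntegral_congr_fun measurableSet_Ioo fun x hx => by simp only [hz x hx, add_mul]
    _ = ∫ x in Ioo a b, (∫ s in a..x, w s) * deriv φ x := by
        rw [integral_add (hφ.integrable_deriv.integrableOn.const_mul c)
          (hφ.integrableOn_mul_deriv hprim), integral_const_mul, hφ.setIntegral_deriv hab,
          mul_zero, zero_add]
    _ = ∫ x in Ioo a b, (∫ s in Iic x, w s ∂volume.restrict (Ioo a b)) * deriv φ x :=
        setIntegral_congr_fun measurableSet_Ioo fun x hx => by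
          simp only [setIntegral_Iic_restrict_Ioo w (Ioo_subset_Icc_self hx)]
    _ = - ∫ x in Ioo a b, w x * φ x :=
        hφ.integral_Iic_mul_deriv hw (ae_restrict_mem measurableSet_Ioo)

theorem HasWeakDerivOn.eq_add_integral (hab : a < b) {z dz : ℝ → ℝ}
    (h : HasWeakDerivOn a b z dz) (hz : ContinuousOn z (Icc a b))
    (hdz : IntegrableOn dz (Ioo a b)) {x : ℝ} (hx : x ∈ Icc a b) :
    z x = z a + ∫ s in a..x, dz s := by
  have hprim := continuousOn_primitive_of_integrableOn_Ioo hab.le hdz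
  have hprim_weak : HasWeakDerivOn a b (fun x => ∫ s in a..x, dz s) dz :=
    hasWeakDerivOn_primitive hab.le (c := 0) hdz fun x _ => (zero_add _).symm
  have hzi : IntegrableOn z (Ioo a b) := hz.integrableOn_Icc.mono_set Ioo_subset_Icc_self
  have hpi : IntegrableOn (fun x => ∫ s in a..x, dz s) (Ioo a b) :=
    hprim.integrableOn_Icc.mono_set Ioo_subset_Icc_self
  obtain ⟨c, hc⟩ := ae_eq_const_of_integral_mul_deriv_eq_zero hab (hzi.sub hpi) fun φ hφ => by
    simp only [Pi.sub_apply, sub_mul]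
    rw [integral_sub (hφ.integrableOn_mul_deriv hzi) (hφ.integrableOn_mul_deriv hpi), h φ hφ,
      hprim_weak φ hφ, sub_self]
  have heq : EqOn (fun x => z x - ∫ s in a..x, dz s) (fun _ => c) (Icc a b) :=
    Measure.eqOn_Icc_of_ae_eq volume hab.ne (by rwa [← restrict_Ioo_eq_restrict_Icc])
      (hz.sub hprim) continuousOn_const
  have ha := heq (left_mem_Icc.2 hab.le)
  simp only [intervalIntegral.integral_same, sub_zero] at ha
  linarith [heq hx]

end Interval

section BoundedVariation

variable {a b : ℝ}

theorem measurable_measureReal_Iic (m : Measure ℝ) [IsFiniteMeasure m] :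
    Measurable fun x => m.real (Iic x) :=
  Monotone.measurable fun _ _ hxy => measureReal_mono (Iic_subset_Iic.2 hxy)

theorem norm_measureReal_Iic_le (m : Measure ℝ) [IsFiniteMeasure m] (x : ℝ) :
    ‖m.real (Iic x)‖ ≤ m.real univ := by
  rw [Real.norm_of_nonneg measureReal_nonneg]
  exact measureReal_mono (subset_univ _)

theorem integrable_measureReal_Iic_mul (m : Measure ℝ) [IsFiniteMeasure m] {n : Measure ℝ}
    {f : ℝ → ℝ} (hf : Integrable f n) : Integrable (fun x => m.real (Iic x) * f x) n :=
  hf.bdd_mul (measurable_measureReal_Iic m).aestronglyMeasurable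
    (Filter.Eventually.of_forall (norm_measureReal_Iic_le m))

theorem integrableOn_measureReal_Iic (m : Measure ℝ) [IsFiniteMeasure m] :
    IntegrableOn (fun x => m.real (Iic x)) (Ioo a b) := by
  have hone : IntegrableOn (fun _ => (1 : ℝ)) (Ioo a b) := integrableOn_const (by simp)
  exact (integrable_measureReal_Iic_mul m hone).congr (by simp)

theorem integral_measureReal_Iic_mul (m : Measure ℝ) [IsFiniteMeasure m] {n : Measure ℝ}
    [SFinite n] {f : ℝ → ℝ} (hf : Integrable f n) :
    ∫ x, m.real (Iic x) * f x ∂n = ∫ s, ∫ x in Ici s, f x ∂n ∂m := by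
  simpa using integral_setIntegral_Iic_mul (m := m) (integrable_const (1 : ℝ)) hf

theorem IsTestFunction.integral_measureReal_Iic_mul_deriv {φ : ℝ → ℝ} (h : IsTestFunction a b φ)
    {m : Measure ℝ} [IsFiniteMeasure m] (hm : ∀ᵐ s ∂m, s ∈ Ioo a b) :
    ∫ x in Ioo a b, m.real (Iic x) * deriv φ x = - ∫ s, φ s ∂m := by
  simpa using h.integral_Iic_mul_deriv (integrable_const (1 : ℝ)) hm

namespace IsBVOn

variable {u v : ℝ → ℝ}

theorem exists_ae_eq_measureReal_Iic (h : IsBVOn a b u) (hab : a < b) :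
    ∃ (c : ℝ) (μ ν : Measure ℝ), IsFiniteMeasure μ ∧ IsFiniteMeasure ν ∧
      (∀ᵐ s ∂μ, s ∈ Ioo a b) ∧ (∀ᵐ s ∂ν, s ∈ Ioo a b) ∧
      ∀ᵐ x ∂(volume.restrict (Ioo a b)), u x = c + (μ.real (Iic x) - ν.real (Iic x)) := by
  obtain ⟨hu, μ, ν, hμ, hν, hderiv⟩ := h
  have hμ' := ae_restrict_mem (μ := μ) (measurableSet_Ioo (a := a) (b := b))
  have hν' := ae_restrict_mem (μ := ν) (measurableSet_Ioo (a := a) (b := b))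
  set μ' := μ.restrict (Ioo a b)
  set ν' := ν.restrict (Ioo a b)
  have hi := (integrableOn_measureReal_Iic (a := a) (b := b) μ').sub
    (integrableOn_measureReal_Iic (a := a) (b := b) ν')
  obtain ⟨c, hc⟩ := ae_eq_const_of_integral_mul_deriv_eq_zero hab (hu.sub hi) fun φ hφ => by
    have hres : ∀ m : Measure ℝ, ∫ x, φ x ∂m.restrict (Ioo a b) = ∫ x, φ x ∂m := fun m =>
      setIntegral_eq_integral_of_forall_compl_eq_zero fun x hx => hφ.apply_eq_zero hx
    have hd := hφ.integrable_deriv.integrableOn (s := Ioo a b)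
    have hdμ := integrable_measureReal_Iic_mul μ' hd
    have hdν := integrable_measureReal_Iic_mul ν' hd
    simp only [Pi.sub_apply, sub_mul]
    rw [integral_sub (hφ.integrableOn_mul_deriv hu) (IntegrableOn.fun_sub hdμ hdν),
      integral_sub hdμ hdν, hderiv φ hφ,
      hφ.integral_measureReal_Iic_mul_deriv hμ', hφ.integral_measureReal_Iic_mul_deriv hν',
      hres, hres]
    ring
  refine ⟨c, μ', ν', inferInstance, inferInstance, hμ', hν', ?_⟩
  filter_upwards [hc] with x hx
  exact eq_add_of_sub_eq hx

theorem exists_ae_abs_le (h : IsBVOn a b u) (hab : a < b) :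
    ∃ C, ∀ᵐ x ∂(volume.restrict (Ioo a b)), |u x| ≤ C := by
  obtain ⟨c, μ, ν, _, _, -, -, hu⟩ := h.exists_ae_eq_measureReal_Iic hab
  refine ⟨|c| + (μ.real univ + ν.real univ), ?_⟩
  filter_upwards [hu] with x hx
  rw [hx]
  exact (abs_add_le _ _).trans (add_le_add_right ((abs_sub _ _).trans
    (add_le_add (norm_measureReal_Iic_le μ x) (norm_measureReal_Iic_le ν x))) _)

theorem exists_abs_integral_mul_le (h : IsBVOn a b u) (hab : a < b) :
    ∃ C, 0 ≤ C ∧ ∀ (w : ℝ → ℝ) (M : ℝ), IntegrableOn w (Ioo a b) →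
      (∀ x ∈ Icc a b, |∫ s in x..b, w s| ≤ M) → |∫ x in Ioo a b, u x * w x| ≤ C * M := by
  obtain ⟨c, μ, ν, _, _, hμ, hν, hu⟩ := h.exists_ae_eq_measureReal_Iic hab
  refine ⟨|c| + (μ.real univ + ν.real univ), by positivity, fun w M hw hM => ?_⟩
  have hmeasure : ∀ (m : Measure ℝ) [IsFiniteMeasure m], (∀ᵐ s ∂m, s ∈ Ioo a b) →
      |∫ x in Ioo a b, m.real (Iic x) * w x| ≤ m.real univ * M := by
    intro m _ hm
    rw [integral_measureReal_Iic_mul m hw, mul_comm]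
    refine norm_integral_le_of_norm_le_const (G := ℝ) ?_
    filter_upwards [hm] with s hs
    rw [setIntegral_Ici_restrict_Ioo w (Ioo_subset_Icc_self hs)]
    exact hM s (Ioo_subset_Icc_self hs)
  have hμi := integrable_measureReal_Iic_mul μ hw
  have hνi := integrable_measureReal_Iic_mul ν hw
  calc |∫ x in Ioo a b, u x * w x|
      = |c * (∫ x in a..b, w x) + ((∫ x in Ioo a b, μ.real (Iic x) * w x)
          - ∫ x in Ioo a b, ν.real (Iic x) * w x)| := by
        rw [← setIntegral_Ioo_eq_intervalIntegral hab.le, ← integral_const_mul,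
          ← integral_sub hμi hνi, ← integral_add (hw.const_mul c) (IntegrableOn.fun_sub hμi hνi)]
        congr 1
        refine integral_congr_ae ?_
        filter_upwards [hu] with x hx
        simp only [hx, add_mul, sub_mul]
    _ ≤ |c| * M + (μ.real univ * M + ν.real univ * M) := by
        refine (abs_add_le _ _).trans (add_le_add ?_ ((abs_sub _ _).trans
          (add_le_add (hmeasure μ hμ) (hmeasure ν hν))))
        rw [abs_mul]
        gcongr
        exact hM a (left_mem_Icc.2 hab.le)
    _ = _ := by ring

theorem congr_ae (h : IsBVOn a b u) (huv : u =ᵐ[volume.restrict (Ioo a b)] v) :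
    IsBVOn a b v := by
  obtain ⟨hu, μ, ν, hμ, hν, hderiv⟩ := h
  refine ⟨hu.congr huv, μ, ν, hμ, hν, fun φ hφ => ?_⟩
  rw [← hderiv φ hφ]
  refine integral_congr_ae ?_
  filter_upwards [huv] with x hx
  rw [hx]

theorem neg (h : IsBVOn a b u) : IsBVOn a b fun x => - u x := by
  obtain ⟨hu, μ, ν, hμ, hν, hderiv⟩ := h
  refine ⟨hu.neg, ν, μ, hν, hμ, fun φ hφ => ?_⟩
  simp only [neg_mul, integral_neg, hderiv φ hφ]
  ring

theorem add (hu : IsBVOn a b u) (hv : IsBVOn a b v) : IsBVOn a b fun x => u x + v x := by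
  obtain ⟨hui, μ, ν, hμ, hν, huderiv⟩ := hu
  obtain ⟨hvi, μ', ν', hμ', hν', hvderiv⟩ := hv
  refine ⟨hui.add hvi, μ + μ', ν + ν', inferInstance, inferInstance, fun φ hφ => ?_⟩
  have hφi : ∀ (m : Measure ℝ) [IsFiniteMeasure m], Integrable φ m := fun m _ =>
    hφ.1.continuous.integrable_of_hasCompactSupport hφ.2.1
  simp only [add_mul]
  rw [integral_add (hφ.integrableOn_mul_deriv hui) (hφ.integrableOn_mul_deriv hvi), huderiv φ hφ,
    hvderiv φ hφ, integral_add_measure (hφi μ) (hφi μ'), integral_add_measure (hφi ν) (hφi ν')]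
  ring

theorem const_mul (h : IsBVOn a b u) {c : ℝ} (hc : 0 ≤ c) : IsBVOn a b fun x => c * u x := by
  obtain ⟨hu, μ, ν, hμ, hν, hderiv⟩ := h
  refine ⟨hu.const_mul c, c.toNNReal • μ, c.toNNReal • ν, inferInstance, inferInstance,
    fun φ hφ => ?_⟩
  simp only [mul_assoc, integral_const_mul, hderiv φ hφ, integral_smul_nnreal_measure,
    NNReal.smul_def, Real.coe_toNNReal c hc, smul_eq_mul]
  ring

theorem zero : IsBVOn a b fun _ => 0 :=
  ⟨integrableOn_zero, 0, 0, inferInstance, inferInstance, fun φ _ => by simp⟩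

theorem sum {ι : Type*} (s : Finset ι) {f : ι → ℝ → ℝ} (h : ∀ i ∈ s, IsBVOn a b (f i)) :
    IsBVOn a b fun x => ∑ i ∈ s, f i x := by
  classical
  induction s using Finset.induction_on with
  | empty => simpa using zero
  | insert i s hi ih =>
    simp only [Finset.sum_insert hi]
    exact (h i (s.mem_insert_self i)).add (ih fun j hj => h j (Finset.mem_insert_of_mem hj))

theorem indicator_Ioo {p q : ℝ} (hp : a ≤ p) (hpq : p ≤ q) (hq : q ≤ b) :
    IsBVOn a b ((Ioo p q).indicator 1) := by
  refine ⟨(integrableOn_const (C := (1 : ℝ)) (by simp)).indicator measurableSet_Ioo,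
    Measure.dirac p, Measure.dirac q, inferInstance, inferInstance, fun φ hφ => ?_⟩
  have hφ_Ioo : ∫ x in Ioo a b, (Ioo p q).indicator 1 x * deriv φ x = ∫ x in p..q, deriv φ x := by
    simp only [← indicator_mul_left, Pi.one_apply, one_mul]
    rw [setIntegral_indicator measurableSet_Ioo,
      inter_eq_right.2 (Ioo_subset_Ioo hp hq), setIntegral_Ioo_eq_intervalIntegral hpq]
  rw [hφ_Ioo, integral_dirac, integral_dirac, intervalIntegral.integral_deriv_eq_sub
    (fun x _ => hφ.1.differentiable (by simp) x) hφ.integrable_deriv.intervalIntegrable]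
  ring

theorem const (hab : a ≤ b) (c : ℝ) : IsBVOn a b fun _ => c := by
  refine ⟨integrableOn_const (by simp), 0, 0, inferInstance, inferInstance, fun φ hφ => ?_⟩
  simp [integral_const_mul, hφ.setIntegral_deriv hab]

end IsBVOn

end BoundedVariation

section Flow

variable {V E : Type*} [Fintype E]

open Classical in
/-- The net flow out of the vertex `v`, where the edge `e` carries the flow `a e` from `ini e` to
`ter e`. -/
def netOutflow (ini ter : E → V) (a : E → ℝ) (v : V) : ℝ :=
  ∑ e with ini e = v, a e - ∑ e with ter e = v, a e

theorem isLinearMap_netOutflow (ini ter : E → V) : IsLinearMap ℝ (netOutflow ini ter) where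
  map_add a b := by
    ext v
    simp only [netOutflow, Pi.add_apply, Finset.sum_add_distrib]
    ring
  map_smul c a := by
    ext v
    simp only [netOutflow, Pi.smul_apply, smul_eq_mul, ← Finset.mul_sum]
    ring

variable [Fintype V]

theorem sum_mul_nonneg_of_sum_superlevel_nonneg {π y : V → ℝ} (hy : ∑ v, y v = 0)
    (h : ∀ t, 0 ≤ ∑ v with t < π v, y v) : 0 ≤ ∑ v, π v * y v := by
  obtain ⟨m, hm⟩ := (finite_range π).bddBelow
  obtain ⟨M, hM⟩ := (finite_range π).bddAbove
  have hlayer : ∀ v, ∫ t in m..M, (Iio (π v)).indicator (fun _ => y v) t = (π v - m) * y v := by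
    intro v
    have hmv := hm (mem_range_self v)
    have hMv := hM (mem_range_self v)
    rw [← setIntegral_Ioo_eq_intervalIntegral (hmv.trans hMv), setIntegral_indicator
      measurableSet_Iio, Ioo_inter_Iio, min_eq_right hMv]
    simp [hmv]
  calc (0 : ℝ) ≤ ∫ t in m..M, ∑ v with t < π v, y v := by
        rcases isEmpty_or_nonempty V with hV | ⟨⟨v⟩⟩
        · simp
        · exact intervalIntegral.integral_nonneg
            ((hm (mem_range_self v)).trans (hM (mem_range_self v))) fun t _ => h t
    _ = ∫ t in m..M, ∑ v, (Iio (π v)).indicator (fun _ => y v) t := by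
        simp only [Finset.sum_filter, indicator, mem_Iio]
    _ = ∑ v, (π v - m) * y v := by
        rw [intervalIntegral.integral_finsetSum fun v _ => ?_]
        · exact Finset.sum_congr rfl fun v _ => hlayer v
        · rw [intervalIntegrable_iff]
          exact (integrableOn_const (by simp)).indicator measurableSet_Iio
    _ = ∑ v, π v * y v := by
        simp only [sub_mul, Finset.sum_sub_distrib, ← Finset.mul_sum, hy, mul_zero, sub_zero]

open Classical in
theorem sum_mul_sum_fiberwise (f : E → V) (a : E → ℝ) (π : V → ℝ) :
    ∑ v, π v * ∑ e with f e = v, a e = ∑ e, a e * π (f e) := by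
  simp only [Finset.mul_sum, Finset.sum_filter, mul_ite, mul_zero]
  rw [Finset.sum_comm]
  simp [mul_comm]

theorem sum_mul_netOutflow (ini ter : E → V) (a : E → ℝ) (π : V → ℝ) :
    ∑ v, π v * netOutflow ini ter a v = ∑ e, a e * (π (ini e) - π (ter e)) := by
  simp only [netOutflow, mul_sub, Finset.sum_sub_distrib, sum_mul_sum_fiberwise]

open Classical in
theorem sum_filter_netOutflow (ini ter : E → V) (a : E → ℝ) (S : Set V) :
    ∑ v with v ∈ S, netOutflow ini ter a v =
      ∑ e, a e * (S.indicator 1 (ini e) - S.indicator 1 (ter e)) := by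
  rw [← sum_mul_netOutflow]
  simp [Finset.sum_filter, indicator]

theorem sum_netOutflow (ini ter : E → V) (a : E → ℝ) : ∑ v, netOutflow ini ter a v = 0 := by
  simpa using sum_mul_netOutflow ini ter a 1

open Classical in
theorem exists_forall_sum_superlevel_netOutflow_le (ini ter : E → V) {lo hi : E → ℝ}
    (hle : lo ≤ hi) (π : V → ℝ) :
    ∃ a ∈ Icc lo hi, ∀ b ∈ Icc lo hi, ∀ t,
      ∑ v with t < π v, netOutflow ini ter b v ≤ ∑ v with t < π v, netOutflow ini ter a v := by
  set a : E → ℝ := fun e => if π (ter e) < π (ini e) then hi e else lo e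
  refine ⟨a, ⟨fun e => by simp only [a]; split_ifs; exacts [hle e, le_rfl],
    fun e => by simp only [a]; split_ifs; exacts [le_rfl, hle e]⟩, fun b hb t => ?_⟩
  change ∑ v with v ∈ {v | t < π v}, _ ≤ ∑ v with v ∈ {v | t < π v}, _
  simp only [sum_filter_netOutflow]
  refine Finset.sum_le_sum fun e _ => ?_
  have hlo := hb.1 e
  have hhi := hb.2 e
  by_cases hini : t < π (ini e) <;> by_cases hter : t < π (ter e) <;>
    simp only [indicator, mem_ofPred_eq, hini, hter, if_true, if_false, a, Pi.one_apply]
  · simp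
  · simpa [(not_lt.1 hter).trans_lt hini] using hhi
  · simpa [((not_lt.1 hini).trans hter.le).not_gt] using hlo
  · simp

open Classical in
/-- Hoffman's circulation theorem: a feasible flow exists when every cut admits one. A potential
separating `d` from the feasible net outflows would be maximized by a flow that is extremal on all
superlevel sets of the potential at once. -/
theorem exists_netOutflow_eq (ini ter : E → V) {lo hi : E → ℝ} (hle : lo ≤ hi) {d : V → ℝ}
    (hd : ∑ v, d v = 0)
    (hcut : ∀ S : Set V, ∃ a ∈ Icc lo hi,
      ∑ v with v ∈ S, d v ≤ ∑ v with v ∈ S, netOutflow ini ter a v) :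
    ∃ a ∈ Icc lo hi, netOutflow ini ter a = d := by
  have hlin := isLinearMap_netOutflow ini ter
  have hcont : Continuous (netOutflow ini ter) := hlin.mk'.continuous_of_finiteDimensional
  by_contra! hne
  obtain ⟨f, u, hfu, hud⟩ := geometric_hahn_banach_closed_point
    ((convex_Icc lo hi).is_linear_image hlin) (isCompact_Icc.image hcont).isClosed
    (fun ⟨a, ha, had⟩ => hne a ha had)
  set π : V → ℝ := fun v => f (Pi.single v 1) with hπ
  have hf : ∀ y, f y = ∑ v, π v * y v := fun y => by
    conv_lhs => rw [pi_eq_sum_univ' y]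
    simp [hπ, mul_comm]
  obtain ⟨a, ha, hmax⟩ := exists_forall_sum_superlevel_netOutflow_le ini ter hle π
  have hsuper : ∀ t, 0 ≤ ∑ v with t < π v, (netOutflow ini ter a v - d v) := fun t => by
    obtain ⟨b, hb, hbd⟩ := hcut {v | t < π v}
    rw [Finset.sum_sub_distrib, sub_nonneg]
    exact hbd.trans (hmax b hb t)
  have hlayer := sum_mul_nonneg_of_sum_superlevel_nonneg
    (by rw [Finset.sum_sub_distrib, sum_netOutflow, hd, sub_zero]) hsuper
  simp only [mul_sub, Finset.sum_sub_distrib, ← hf] at hlayer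
  linarith [hfu _ (mem_image_of_mem _ ha)]

end Flow

namespace MetricGraph

section Functions

variable {V E : Type*} {Γ : MetricGraph V E} {u v f : E → ℝ → ℝ}

variable (Γ) in
/-- `u ∈ L¹(Γ)`. -/
def IsL1 (u : E → ℝ → ℝ) : Prop := ∀ e, IntegrableOn (u e) (Γ.edge e)

variable (Γ) in
/-- `u ∈ L^∞(Γ)`. -/
def IsLInfty (u : E → ℝ → ℝ) : Prop := ∀ e, MemLp (u e) ⊤ (volume.restrict (Γ.edge e))

variable (Γ) in
theorem measurableSet_edge (e : E) : MeasurableSet (Γ.edge e) := measurableSet_Ioo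

variable (Γ) in
theorem volume_real_edge (e : E) : volume.real (Γ.edge e) = Γ.len e := by
  simp [edge, (Γ.len_pos e).le]

instance (e : E) : IsFiniteMeasure (volume.restrict (Γ.edge e)) := ⟨by simp [edge]⟩

theorem IsL2.isL1 (h : Γ.IsL2 u) : Γ.IsL1 u := fun e => (h e).integrable one_le_two

theorem IsLInfty.isL2 (h : Γ.IsLInfty u) : Γ.IsL2 u := fun e => (h e).mono_exponent le_top

theorem IsL1.isLInfty_mul (hf : Γ.IsL1 f) (hu : Γ.IsLInfty u) :
    Γ.IsL1 fun e x => u e x * f e x := fun e => (hf e).mul_of_top_right (hu e)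

theorem IsL1.add (hu : Γ.IsL1 u) (hv : Γ.IsL1 v) : Γ.IsL1 fun e x => u e x + v e x :=
  fun e => (hu e).add (hv e)

theorem IsL1.const_mul (hu : Γ.IsL1 u) (c : ℝ) : Γ.IsL1 fun e x => c * u e x :=
  fun e => (hu e).const_mul c

theorem IsBV.isL1 (h : Γ.IsBV u) : Γ.IsL1 u := fun e => (h e).1

theorem IsBV.isLInfty (h : Γ.IsBV u) : Γ.IsLInfty u := fun e => by
  obtain ⟨C, hC⟩ := (h e).exists_ae_abs_le (Γ.len_pos e)
  exact memLp_top_of_bound (h e).1.1 C hC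

variable [Fintype E]

theorem integral_add (hu : Γ.IsL1 u) (hv : Γ.IsL1 v) :
    Γ.integral (fun e x => u e x + v e x) = Γ.integral u + Γ.integral v := by
  simp only [integral, ← Finset.sum_add_distrib]
  exact Finset.sum_congr rfl fun e _ => MeasureTheory.integral_add (hu e) (hv e)

theorem integral_sub (hu : Γ.IsL1 u) (hv : Γ.IsL1 v) :
    Γ.integral (fun e x => u e x - v e x) = Γ.integral u - Γ.integral v := by
  simp only [integral, ← Finset.sum_sub_distrib]
  exact Finset.sum_congr rfl fun e _ => MeasureTheory.integral_sub (hu e) (hv e)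

theorem integral_const_mul (c : ℝ) (u : E → ℝ → ℝ) :
    Γ.integral (fun e x => c * u e x) = c * Γ.integral u := by
  simp only [integral, Finset.mul_sum, MeasureTheory.integral_const_mul]

theorem integral_neg (u : E → ℝ → ℝ) : Γ.integral (fun e x => -u e x) = -Γ.integral u := by
  simp only [integral, Finset.sum_neg_distrib, MeasureTheory.integral_neg]

theorem integral_const (c : ℝ) : Γ.integral (fun _ _ => c) = c * Γ.totalLength := by
  simp [integral, totalLength, Finset.mul_sum, volume_real_edge, mul_comm]

theorem integral_congr (h : ∀ e, ∀ᵐ x ∂volume.restrict (Γ.edge e), u e x = v e x) :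
    Γ.integral u = Γ.integral v :=
  Finset.sum_congr rfl fun e _ => integral_congr_ae (h e)

theorem integral_mono (hu : Γ.IsL1 u) (hv : Γ.IsL1 v)
    (h : ∀ e, ∀ᵐ x ∂volume.restrict (Γ.edge e), u e x ≤ v e x) : Γ.integral u ≤ Γ.integral v :=
  Finset.sum_le_sum fun e _ => integral_mono_ae (hu e) (hv e) (h e)

end Functions

section Fields

variable {V E : Type*} {Γ : MetricGraph V E} {z dz w dw : E → ℝ → ℝ}

theorem isW12_iff : Γ.IsW12 z dz ↔
    Γ.IsL2 dz ∧ ∀ e, ∀ x ∈ Icc 0 (Γ.len e), z e x = z e 0 + ∫ s in (0 : ℝ)..x, dz e s := by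
  refine ⟨fun ⟨_, hdz, hweak, hcont⟩ => ⟨hdz, fun e x hx =>
    (hweak e).eq_add_integral (Γ.len_pos e) (hcont e) (hdz.isL1 e) hx⟩, fun ⟨hdz, h⟩ => ?_⟩
  have hcont : ∀ e, ContinuousOn (z e) (Icc 0 (Γ.len e)) := fun e =>
    (continuousOn_const.add (continuousOn_primitive_of_integrableOn_Ioo (Γ.len_pos e).le
      (hdz.isL1 e))).congr (h e)
  refine ⟨fun e => ?_, hdz, fun e => hasWeakDerivOn_primitive (Γ.len_pos e).le (hdz.isL1 e)
    fun x hx => h e x (Ioo_subset_Icc_self hx), hcont⟩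
  obtain ⟨C, hC⟩ := isCompact_Icc.exists_bound_of_continuousOn (hcont e)
  refine MemLp.of_bound (((hcont e).mono Ioo_subset_Icc_self).aestronglyMeasurable
    measurableSet_Ioo) C ?_
  filter_upwards [ae_restrict_mem (Γ.measurableSet_edge e)] with x hx
  exact hC x (Ioo_subset_Icc_self hx)

theorem IsW12.add_const_mul (hz : Γ.IsW12 z dz) (hw : Γ.IsW12 w dw) (c : ℝ) :
    Γ.IsW12 (fun e x => z e x + c * w e x) fun e x => dz e x + c * dw e x := by
  rw [isW12_iff] at hz hw ⊢
  refine ⟨fun e => (hz.1 e).add ((hw.1 e).const_mul c), fun e x hx => ?_⟩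
  have h0 : (0 : ℝ) ∈ Icc 0 (Γ.len e) := left_mem_Icc.2 (Γ.len_pos e).le
  rw [intervalIntegral.integral_add (intervalIntegrable_of_integrableOn_Ioo (hz.1.isL1 e) h0 hx)
      ((intervalIntegrable_of_integrableOn_Ioo (hw.1.isL1 e) h0 hx).const_mul c),
    intervalIntegral.integral_const_mul, hz.2 e x hx, hw.2 e x hx]
  ring

variable (Γ) in
/-- The vertex at an end `i` of an edge: the pairs `(e, true)` and `(e, false)` stand for the
terminal and the initial end of the edge `e`. -/
def endVertex (i : E × Bool) : V := if i.2 then Γ.ter i.1 else Γ.ini i.1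

variable (Γ) in
/-- The flux of the field `z` out of the edge through its end `i`. -/
def endFlux (z : E → ℝ → ℝ) (i : E × Bool) : ℝ := if i.2 then z i.1 (Γ.len i.1) else -z i.1 0

theorem endFlux_add_const_mul (z w : E → ℝ → ℝ) (c : ℝ) (i : E × Bool) :
    Γ.endFlux (fun e x => z e x + c * w e x) i = Γ.endFlux z i + c * Γ.endFlux w i := by
  simp only [endFlux]
  split_ifs <;> ring

variable [Fintype E]

open Classical in
theorem sum_vertexValue (z : E → ℝ → ℝ) (v : V) :
    ∑ e with (v = Γ.ini e ∨ v = Γ.ter e), Γ.vertexValue z e v =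
      ∑ i with Γ.endVertex i = v, Γ.endFlux z i := by
  rw [Finset.sum_filter, Finset.sum_filter, Fintype.sum_prod_type]
  refine Finset.sum_congr rfl fun e _ => ?_
  by_cases hter : v = Γ.ter e
  · simp [endVertex, endFlux, vertexValue, hter, Γ.no_loops e]
  · simp [endVertex, endFlux, vertexValue, hter, eq_comm (b := v)]

theorem isXK_iff [Finite V] : Γ.IsXK z dz ↔
    Γ.IsW12 z dz ∧ ∀ g : V → ℝ, ∑ i, g (Γ.endVertex i) * Γ.endFlux z i = 0 := by
  classical
  cases nonempty_fintype V
  refine and_congr_right fun _ => ⟨fun h g => ?_, fun h v => ?_⟩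
  · calc ∑ i, g (Γ.endVertex i) * Γ.endFlux z i
        = ∑ v, g v * ∑ i with Γ.endVertex i = v, Γ.endFlux z i := by
          simp only [sum_mul_sum_fiberwise, mul_comm]
      _ = 0 := Finset.sum_eq_zero fun v _ => by
          rw [mul_eq_zero]
          right
          convert h v using 1
          convert (sum_vertexValue z v).symm
  · rw [sum_vertexValue, ← h (Pi.single v 1)]
    simp [Finset.sum_filter, Pi.single_apply]

theorem IsXK.eq_add_integral (h : Γ.IsXK z dz) (e : E) {x : ℝ} (hx : x ∈ Icc 0 (Γ.len e)) :
    z e x = z e 0 + ∫ s in (0 : ℝ)..x, dz e s :=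
  (isW12_iff.1 h.1).2 e x hx

theorem IsXK.isL2_deriv (h : Γ.IsXK z dz) : Γ.IsL2 dz := h.1.2.1

theorem IsXK.continuousOn (h : Γ.IsXK z dz) (e : E) : ContinuousOn (z e) (Icc 0 (Γ.len e)) :=
  h.1.2.2.2 e

theorem IsXK.sub_eq_integral (h : Γ.IsXK z dz) (e : E) {x y : ℝ} (hx : x ∈ Icc 0 (Γ.len e))
    (hy : y ∈ Icc 0 (Γ.len e)) : z e y - z e x = ∫ s in x..y, dz e s := by
  have hdz := h.isL2_deriv.isL1 e
  have h0 : (0 : ℝ) ∈ Icc 0 (Γ.len e) := left_mem_Icc.2 (Γ.len_pos e).le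
  rw [h.eq_add_integral e hx, h.eq_add_integral e hy, add_sub_add_left_eq_sub,
    intervalIntegral.integral_interval_sub_left (intervalIntegrable_of_integrableOn_Ioo hdz h0 hy)
      (intervalIntegrable_of_integrableOn_Ioo hdz h0 hx)]

theorem IsXK.add_const_mul [Finite V] (hz : Γ.IsXK z dz) (hw : Γ.IsXK w dw) (c : ℝ) :
    Γ.IsXK (fun e x => z e x + c * w e x) fun e x => dz e x + c * dw e x :=
  isXK_iff.2 ⟨hz.1.add_const_mul hw.1 c, fun g => by
    simp only [endFlux_add_const_mul, mul_add, Finset.sum_add_distrib, (isXK_iff.1 hz).2 g,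
      mul_left_comm _ c, ← Finset.mul_sum, (isXK_iff.1 hw).2 g, mul_zero, add_zero]⟩

theorem isXK_zero [Finite V] : Γ.IsXK 0 0 :=
  isXK_iff.2 ⟨isW12_iff.2 ⟨fun _ => MemLp.zero', by simp⟩, fun g => by simp [endFlux]⟩

theorem IsXK.const_mul [Finite V] (hz : Γ.IsXK z dz) (c : ℝ) :
    Γ.IsXK (fun e x => c * z e x) fun e x => c * dz e x := by
  simpa using isXK_zero.add_const_mul hz c

theorem IsXK.integral_deriv [Finite V] (h : Γ.IsXK z dz) : Γ.integral dz = 0 := by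
  calc Γ.integral dz = ∑ e, (z e (Γ.len e) - z e 0) :=
        Finset.sum_congr rfl fun e _ => by
          rw [h.sub_eq_integral e (left_mem_Icc.2 (Γ.len_pos e).le)
            (right_mem_Icc.2 (Γ.len_pos e).le), edge, setIntegral_Ioo_eq_intervalIntegral
            (Γ.len_pos e).le]
    _ = ∑ i, 1 * Γ.endFlux z i := by
        simp [Fintype.sum_prod_type, endFlux, sub_eq_add_neg]
    _ = 0 := (isXK_iff.1 h).2 fun _ => 1

theorem IsXK.ae_abs_le_iff (h : Γ.IsXK z dz) (e : E) (M : ℝ) :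
    (∀ᵐ x ∂volume.restrict (Γ.edge e), |z e x| ≤ M) ↔ ∀ x ∈ Icc 0 (Γ.len e), |z e x| ≤ M := by
  refine ⟨fun hae => ?_, fun hle => ?_⟩
  · have heq : EqOn (fun x => max |z e x| M) (fun _ => M) (Icc 0 (Γ.len e)) := by
      refine Measure.eqOn_Icc_of_ae_eq volume (Γ.len_pos e).ne ?_
        ((h.continuousOn e).abs.sup continuousOn_const) continuousOn_const
      rw [← restrict_Ioo_eq_restrict_Icc]
      filter_upwards [hae] with x hx using max_eq_right hx
    exact fun x hx => max_eq_right_iff.1 (heq hx)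
  · filter_upwards [ae_restrict_mem (Γ.measurableSet_edge e)] with x hx
    exact hle x (Ioo_subset_Icc_self hx)

end Fields

section TotalVariation

variable {V E : Type*} [Fintype E] {Γ : MetricGraph V E} {u v z dz : E → ℝ → ℝ}

variable (Γ) in
/-- The pairs `(z, z')` of a field `z ∈ X_K(Γ)` with `‖z‖_∞ ≤ 1` and its derivative, over which the
supremum in `TV` is taken. -/
def IsAdmissible (z dz : E → ℝ → ℝ) : Prop :=
  Γ.IsXK z dz ∧ ∀ e, ∀ x ∈ Icc 0 (Γ.len e), |z e x| ≤ 1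

theorem IsAdmissible.neg [Finite V] (h : Γ.IsAdmissible z dz) :
    Γ.IsAdmissible (fun e x => -z e x) fun e x => -dz e x := by
  simpa [IsAdmissible] using And.intro (h.1.const_mul (-1)) h.2

variable (Γ) in
theorem isAdmissible_zero [Finite V] : Γ.IsAdmissible 0 0 := ⟨isXK_zero, by simp⟩

variable (Γ) in
theorem TV_eq_sSup (u : E → ℝ → ℝ) :
    Γ.TV u =
      sSup {r | ∃ z dz, Γ.IsAdmissible z dz ∧ r = |Γ.integral fun e x => u e x * dz e x|} := by
  refine congr_arg sSup (ext fun r => exists_congr fun z => exists_congr fun dz => ?_)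
  rw [← and_assoc]
  refine and_congr_left fun _ => and_congr_right fun h => forall_congr' fun e => ?_
  exact h.ae_abs_le_iff e 1

theorem TV_le [Finite V] {C : ℝ}
    (h : ∀ z dz, Γ.IsAdmissible z dz → Γ.integral (fun e x => u e x * dz e x) ≤ C) :
    Γ.TV u ≤ C := by
  rw [TV_eq_sSup]
  refine csSup_le ⟨_, _, _, isAdmissible_zero Γ, rfl⟩ ?_
  rintro r ⟨z, dz, hz, rfl⟩
  refine abs_le'.2 ⟨h z dz hz, ?_⟩
  simpa only [mul_neg, integral_neg] using h _ _ hz.neg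

theorem IsBV.integral_mul_le_TV (hu : Γ.IsBV u) (hz : Γ.IsAdmissible z dz) :
    Γ.integral (fun e x => u e x * dz e x) ≤ Γ.TV u := by
  choose C _ hC using fun e => (hu e).exists_abs_integral_mul_le (Γ.len_pos e)
  rw [TV_eq_sSup]
  refine (le_abs_self _).trans (le_csSup ⟨∑ e, C e * 2, ?_⟩ ⟨z, dz, hz, rfl⟩)
  rintro r ⟨z, dz, hz, rfl⟩
  refine (Finset.abs_sum_le_sum_abs _ _).trans (Finset.sum_le_sum fun e _ =>
    hC e (dz e) 2 (hz.1.isL2_deriv.isL1 e) fun x hx => ?_)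
  have hL : Γ.len e ∈ Icc 0 (Γ.len e) := right_mem_Icc.2 (Γ.len_pos e).le
  rw [← hz.1.sub_eq_integral e hx hL]
  exact (abs_sub _ _).trans ((add_le_add (hz.2 e _ hL) (hz.2 e x hx)).trans_eq one_add_one_eq_two)

theorem TV_congr (h : ∀ z dz, Γ.IsAdmissible z dz →
    |Γ.integral fun e x => u e x * dz e x| = |Γ.integral fun e x => v e x * dz e x|) :
    Γ.TV u = Γ.TV v := by
  rw [TV_eq_sSup, TV_eq_sSup]
  refine congr_arg sSup (ext fun r => exists_congr fun z => exists_congr fun dz =>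
    and_congr_right fun hz => ?_)
  rw [h z dz hz]

theorem TV_congr_ae (h : ∀ e, ∀ᵐ x ∂volume.restrict (Γ.edge e), u e x = v e x) :
    Γ.TV u = Γ.TV v :=
  TV_congr fun z dz _ => by
    rw [integral_congr (v := fun e x => v e x * dz e x) fun e => by
      filter_upwards [h e] with x hx
      rw [hx]]

variable (Γ u) in
theorem TV_neg : Γ.TV (-u) = Γ.TV u :=
  TV_congr fun z dz _ => by simp only [Pi.neg_apply, neg_mul, integral_neg, abs_neg]

theorem IsBV.TV_add_const [Finite V] (hu : Γ.IsBV u) (c : ℝ) :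
    Γ.TV (fun e x => u e x + c) = Γ.TV u :=
  TV_congr fun z dz hz => by
    simp only [add_mul]
    rw [integral_add (hz.1.isL2_deriv.isL1.isLInfty_mul hu.isLInfty)
      (hz.1.isL2_deriv.isL1.const_mul c), integral_const_mul, hz.1.integral_deriv, mul_zero,
      add_zero]

variable (Γ) in
theorem TV_const_mul {c : ℝ} (hc : 0 ≤ c) (u : E → ℝ → ℝ) :
    Γ.TV (fun e x => c * u e x) = c * Γ.TV u := by
  rw [TV_eq_sSup, TV_eq_sSup, ← smul_eq_mul, ← Real.sSup_smul_of_nonneg hc]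
  congr 1
  ext r
  simp only [mul_assoc, integral_const_mul, abs_mul, abs_of_nonneg hc, mem_smul_set, smul_eq_mul,
    mem_ofPred_eq]
  constructor
  · rintro ⟨z, dz, hz, rfl⟩
    exact ⟨_, ⟨z, dz, hz, rfl⟩, rfl⟩
  · rintro ⟨_, ⟨z, dz, hz, rfl⟩, rfl⟩
    exact ⟨z, dz, hz, rfl⟩

theorem IsBV.energy_eq (hu : Γ.IsBV u) : Γ.energy u = (Γ.TV u : EReal) := if_pos hu

end TotalVariation

section Sets

variable {V E : Type*} {Γ : MetricGraph V E} {D : E → Set ℝ}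

theorem nullMeasurableSet_of_isL1_chi (hD : Γ.IsL1 (chi D)) (e : E) :
    NullMeasurableSet (D e) (volume.restrict (Γ.edge e)) :=
  (aemeasurable_indicator_const_iff (1 : ℝ)).1 (hD e).1.aemeasurable

theorem isLInfty_chi (hD : Γ.IsL1 (chi D)) : Γ.IsLInfty (chi D) := fun e =>
  memLp_top_of_bound (hD e).1 1 <| .of_forall fun x =>
    (norm_indicator_le_norm_self 1 x).trans (by simp)

theorem chi_compl {e : E} {x : ℝ} (hx : x ∈ Γ.edge e) :
    chi (Γ.compl D) e x = -1 * chi D e x + 1 := by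
  by_cases h : x ∈ D e <;> simp [chi, compl, h, hx]

theorem ae_chi_compl (D : E → Set ℝ) (e : E) :
    ∀ᵐ x ∂volume.restrict (Γ.edge e), chi (Γ.compl D) e x = -1 * chi D e x + 1 := by
  filter_upwards [ae_restrict_mem (Γ.measurableSet_edge e)] with x hx using chi_compl hx

theorem FinitePerimeter.compl (hD : Γ.FinitePerimeter D) : Γ.FinitePerimeter (Γ.compl D) :=
  fun e => (((hD e).neg.add (IsBVOn.const (Γ.len_pos e).le 1)).congr_ae <| by
    filter_upwards [ae_chi_compl D e] with x hx
    simp [hx])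

theorem isL1_chi_superlevel {u : E → ℝ → ℝ} (hu : Γ.IsL1 u) (t : ℝ) :
    Γ.IsL1 (chi (Γ.superlevel u t)) := fun e => by
  have hmeas : NullMeasurableSet (Γ.superlevel u t e) (volume.restrict (Γ.edge e)) :=
    (Γ.measurableSet_edge e).nullMeasurableSet.inter
      (nullMeasurableSet_lt aemeasurable_const (hu e).1.aemeasurable)
  exact (integrable_const (1 : ℝ)).indicator₀ hmeas

variable [Fintype E]

theorem length_eq_integral_chi (hD : Γ.IsL1 (chi D)) : Γ.length D = Γ.integral (chi D) := by
  refine Finset.sum_congr rfl fun e _ => ?_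
  have hmeas := nullMeasurableSet_of_isL1_chi hD e
  rw [chi, integral_indicator₀ hmeas]
  simp [measureReal_restrict_apply₀ hmeas]

theorem length_compl (hD : Γ.IsL1 (chi D)) :
    Γ.length (Γ.compl D) = Γ.totalLength - Γ.length D := by
  rw [length, length, totalLength, ← Finset.sum_sub_distrib]
  refine Finset.sum_congr rfl fun e _ => ?_
  have hmeas := nullMeasurableSet_of_isL1_chi hD e
  have hcompl : Γ.compl D e ∩ Γ.edge e = (D e)ᶜ ∩ Γ.edge e := by
    ext x
    simp [compl, and_comm]
  rw [hcompl, ← measureReal_restrict_apply₀ hmeas.compl, measureReal_compl₀ hmeas,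
    measureReal_restrict_apply₀ hmeas, measureReal_restrict_apply_univ, volume_real_edge]

theorem FinitePerimeter.per_compl [Finite V] (hD : Γ.FinitePerimeter D) :
    Γ.Per (Γ.compl D) = Γ.Per D := by
  have hneg : Γ.IsBV fun e x => -1 * chi D e x := fun e => by simpa using (hD e).neg
  calc Γ.TV (chi (Γ.compl D)) = Γ.TV fun e x => -1 * chi D e x + 1 :=
        TV_congr_ae (ae_chi_compl D)
    _ = Γ.TV (-chi D) := by
        rw [hneg.TV_add_const]
        simp only [neg_one_mul]
        rfl
    _ = Γ.TV (chi D) := TV_neg Γ _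

theorem FinitePerimeter.norm1_const_mul_chi (hD : Γ.FinitePerimeter D) {c : ℝ} (hc : 0 ≤ c) :
    Γ.norm1 (fun e x => c * chi D e x) = c * Γ.length D := by
  have habs : ∀ e x, |c * chi D e x| = c * chi D e x := fun e x =>
    abs_of_nonneg (mul_nonneg hc (indicator_nonneg (fun _ _ => zero_le_one) x))
  simp only [norm1, habs]
  rw [integral_const_mul, length_eq_integral_chi hD.isL1]

variable (Γ) in
theorem totalLength_nonneg : 0 ≤ Γ.totalLength := Finset.sum_nonneg fun e _ => (Γ.len_pos e).le

theorem isMedian_const_mul_chi {c : ℝ} (hc : 0 < c) (hle : Γ.length D ≤ Γ.totalLength / 2) :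
    Γ.IsMedian (fun e x => c * chi D e x) 0 := by
  have hnonneg : ∀ e x, 0 ≤ c * chi D e x := fun e x =>
    mul_nonneg hc.le (indicator_nonneg (fun _ _ => zero_le_one) x)
  have hsub : Γ.length (Γ.sublevel (fun e x => c * chi D e x) 0) = 0 := by
    simp [length, sublevel, (hnonneg _ _).not_gt]
  have hsup : Γ.length (Γ.superlevel (fun e x => c * chi D e x) 0) = Γ.length D := by
    refine Finset.sum_congr rfl fun e _ => congr_arg volume.real (ext fun x => ?_)
    by_cases hx : x ∈ D e <;> simp [superlevel, chi, hx, hc]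
  rw [IsMedian, hsub, hsup]
  exact ⟨div_nonneg (totalLength_nonneg Γ) two_pos.le, hle⟩

theorem FinitePerimeter.mem_competitors (hD : Γ.FinitePerimeter D) (hpos : 0 < Γ.length D)
    (hle : Γ.length D ≤ Γ.totalLength / 2) :
    (fun e x => 1 / Γ.length D * chi D e x) ∈ Γ.competitors :=
  ⟨fun e => (hD e).const_mul (by positivity), by
    rw [hD.norm1_const_mul_chi (by positivity), one_div_mul_cancel hpos.ne'],
    isMedian_const_mul_chi (by positivity) hle⟩

variable (Γ) in
theorem length_nonneg (D : E → Set ℝ) : 0 ≤ Γ.length D :=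
  Finset.sum_nonneg fun _ _ => measureReal_nonneg

variable (Γ) in
theorem TV_inv_length_mul_chi (D : E → Set ℝ) :
    Γ.TV (fun e x => 1 / Γ.length D * chi D e x) = Γ.Per D / Γ.length D := by
  rw [TV_const_mul Γ (one_div_nonneg.2 (length_nonneg Γ D)), one_div_mul_eq_div]
  rfl

variable [Finite V]

theorem cheeger_eq_of_forall_mul_length_le_per {c : ℝ}
    (h : ∀ D', Γ.FinitePerimeter D' → Γ.length D' ≤ Γ.totalLength / 2 →
      c * Γ.length D' ≤ Γ.Per D')
    (hD : Γ.FinitePerimeter D) (hpos : 0 < Γ.length D) (hle : Γ.length D ≤ Γ.totalLength / 2)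
    (hper : Γ.Per D ≤ c * Γ.length D) : Γ.cheeger = c := by
  refine IsLeast.csInf_eq ⟨⟨D, hD, hpos, by linarith, ?_⟩, ?_⟩
  · rw [length_compl hD.isL1, min_eq_left (by linarith), eq_div_iff hpos.ne']
    exact (h D hD hle).antisymm hper
  · rintro r ⟨D', hD', hpos', hlt', rfl⟩
    rw [length_compl hD'.isL1, le_div_iff₀ (lt_min hpos' (by linarith))]
    rcases le_total (Γ.length D') (Γ.totalLength / 2) with hle' | hle'
    · rw [min_eq_left (by linarith)]
      exact h D' hD' hle'
    · rw [min_eq_right (by linarith), ← length_compl hD'.isL1, ← hD'.per_compl]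
      exact h _ hD'.compl (by rw [length_compl hD'.isL1]; linarith)

end Sets

section MaxFlowMinCut

variable {V E : Type*} (Γ : MetricGraph V E)

open Classical in
/-- The set containing the vertices in `S` and bounded by at most one point per edge: if exactly one
end of the edge `e` lies in `S`, then the part of `e` between that end and the point with coordinate
`x e`; otherwise all or nothing of `e`. -/
def cutSet (S : Set V) (x : E → ℝ) (e : E) : Set ℝ :=
  Ioo (if Γ.ini e ∈ S then 0 else x e) (if Γ.ter e ∈ S then Γ.len e else x e)

variable {Γ} in
theorem setIntegral_cutSet {f : ℝ → ℝ} {e : E} (hf : IntegrableOn f (Γ.edge e)) (S : Set V)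
    {x : E → ℝ} (hx : x e ∈ Icc 0 (Γ.len e)) :
    ∫ s in Γ.cutSet S x e, f s = S.indicator 1 (Γ.ter e) * (∫ s in (0 : ℝ)..Γ.len e, f s) +
      (S.indicator 1 (Γ.ini e) - S.indicator 1 (Γ.ter e)) * ∫ s in (0 : ℝ)..x e, f s := by
  have hle := (Γ.len_pos e).le
  have hadd := intervalIntegral.integral_add_adjacent_intervals
    (intervalIntegrable_of_integrableOn_Ioo hf (left_mem_Icc.2 hle) hx)
    (intervalIntegrable_of_integrableOn_Ioo hf hx (right_mem_Icc.2 hle))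
  by_cases hini : Γ.ini e ∈ S <;> by_cases hter : Γ.ter e ∈ S <;>
    simp only [cutSet, hini, hter, if_true, if_false, indicator_of_mem, indicator_of_notMem,
      not_false_eq_true, Pi.one_apply, Ioo_self, setIntegral_empty]
  · rw [setIntegral_Ioo_eq_intervalIntegral hle]
    ring
  · rw [setIntegral_Ioo_eq_intervalIntegral hx.1]
    ring
  · rw [setIntegral_Ioo_eq_intervalIntegral hx.2]
    linarith
  · ring

/-- On an edge leaving `S` the extremal flow is the largest one allowed by `|a + F| ≤ 1`, on an
edge entering `S` the smallest one. -/
theorem exists_flow_eq_of_cut {F : E → ℝ → ℝ} {p q : E → ℝ}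
    (hpq : ∀ e, F e (p e) - F e (q e) ≤ 2) (S : Set V) :
    ∃ a ∈ Icc (fun e => -1 - F e (q e)) (fun e => 1 - F e (p e)), ∃ x : E → ℝ,
      (∀ e, x e = p e ∨ x e = q e) ∧
      ∀ e, a e * (S.indicator 1 (Γ.ini e) - S.indicator 1 (Γ.ter e)) =
        |(S.indicator 1 (Γ.ini e) - S.indicator 1 (Γ.ter e) : ℝ)| -
          (S.indicator 1 (Γ.ini e) - S.indicator 1 (Γ.ter e)) * F e (x e) := by
  classical
  refine ⟨fun e => if Γ.ini e ∈ S then 1 - F e (p e) else -1 - F e (q e), ⟨?_, ?_⟩,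
    fun e => if Γ.ini e ∈ S then p e else q e, fun e => ?_, fun e => ?_⟩
  · intro e
    dsimp only
    split_ifs <;> linarith [hpq e]
  · intro e
    dsimp only
    split_ifs <;> linarith [hpq e]
  · by_cases hini : Γ.ini e ∈ S <;> simp [hini]
  · by_cases hini : Γ.ini e ∈ S <;> by_cases hter : Γ.ter e ∈ S <;> simp [hini, hter]
    ring

variable [Fintype E]

/-- The number of edges joining `S` to its complement. -/
def cutSize (S : Set V) : ℝ :=
  ∑ e, |(S.indicator 1 (Γ.ini e) - S.indicator 1 (Γ.ter e) : ℝ)|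

variable {Γ}

open Classical in
theorem sum_filter_fiberwise_eq [Fintype V] (F : E → ℝ) (S : Set V) :
    ∑ v with v ∈ S, ∑ e with Γ.ter e = v, F e = ∑ e, F e * S.indicator 1 (Γ.ter e) := by
  rw [← sum_mul_sum_fiberwise]
  simp [Finset.sum_filter, indicator]

open Classical in
theorem isXK_of_netOutflow_eq [Finite V] {f : E → ℝ → ℝ} (hf : Γ.IsL2 f) {a : E → ℝ}
    (ha : netOutflow Γ.ini Γ.ter a =
      fun v => ∑ e with Γ.ter e = v, ∫ s in (0 : ℝ)..Γ.len e, f e s) :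
    Γ.IsXK (fun e x => a e + ∫ s in (0 : ℝ)..x, f e s) f := by
  cases nonempty_fintype V
  refine isXK_iff.2 ⟨isW12_iff.2 ⟨hf, by simp⟩, fun g => ?_⟩
  have hflow := sum_mul_netOutflow Γ.ini Γ.ter a g
  rw [ha, sum_mul_sum_fiberwise, ← sub_eq_zero, ← Finset.sum_sub_distrib] at hflow
  rw [Fintype.sum_prod_type]
  refine (Finset.sum_congr rfl fun e _ => ?_).trans hflow
  simp only [Fintype.sum_bool, endVertex, endFlux, if_true, Bool.false_eq_true, if_false,
    intervalIntegral.integral_same]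
  ring

/-- An admissible field with derivative `f` is determined by its values `a e` at the initial ends
of the edges; they form a flow with prescribed net outflow, subject to bounds `lo ≤ a ≤ hi`, and
the flow extremal for a cut of `V` corresponds to the extremal way of cutting the edges. -/
theorem exists_isAdmissible_of_cut [Finite V] {f : E → ℝ → ℝ} (hf : Γ.IsL2 f)
    (hf0 : Γ.integral f = 0)
    (hedge : ∀ e, ∀ x ∈ Icc 0 (Γ.len e), ∀ y ∈ Icc 0 (Γ.len e), ∫ s in x..y, f e s ≤ 2)
    (hcut : ∀ (S : Set V) (x : E → ℝ), (∀ e, x e ∈ Icc 0 (Γ.len e)) →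
      ∑ e, ∫ s in Γ.cutSet S x e, f e s ≤ Γ.cutSize S) :
    ∃ z, Γ.IsAdmissible z f := by
  classical
  cases nonempty_fintype V
  set F : E → ℝ → ℝ := fun e x => ∫ s in (0 : ℝ)..x, f e s with hF
  have hcont : ∀ e, ContinuousOn (F e) (Icc 0 (Γ.len e)) := fun e =>
    continuousOn_primitive_of_integrableOn_Ioo (Γ.len_pos e).le (hf.isL1 e)
  have hint : ∀ e, ∀ x ∈ Icc 0 (Γ.len e), IntervalIntegrable (f e) volume 0 x := fun e x hx =>
    intervalIntegrable_of_integrableOn_Ioo (hf.isL1 e) (left_mem_Icc.2 (Γ.len_pos e).le) hx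
  have hne : ∀ e, (Icc 0 (Γ.len e)).Nonempty := fun e => nonempty_Icc.2 (Γ.len_pos e).le
  choose p hp hmax using fun e => isCompact_Icc.exists_isMaxOn (hne e) (hcont e)
  choose q hq hmin using fun e => isCompact_Icc.exists_isMinOn (hne e) (hcont e)
  have hpq : ∀ e, F e (p e) - F e (q e) ≤ 2 := fun e => by
    have h2 := hedge e (q e) (hq e) (p e) (hp e)
    rwa [← intervalIntegral.integral_interval_sub_left (hint e _ (hp e)) (hint e _ (hq e))] at h2
  have hle : (fun e => -1 - F e (q e)) ≤ fun e => 1 - F e (p e) := fun e => by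
    linarith [hpq e]
  have hd : ∑ v, ∑ e with Γ.ter e = v, F e (Γ.len e) = 0 := by
    rw [← hf0]
    simpa [hF, integral, edge, setIntegral_Ioo_eq_intervalIntegral (Γ.len_pos _).le] using
      sum_filter_fiberwise_eq (Γ := Γ) (fun e => F e (Γ.len e)) univ
  obtain ⟨a, ha, hflow⟩ := exists_netOutflow_eq Γ.ini Γ.ter hle hd fun S => by
    obtain ⟨a, ha, x, hx, hax⟩ := Γ.exists_flow_eq_of_cut hpq S
    have hxmem : ∀ e, x e ∈ Icc 0 (Γ.len e) := fun e => by
      rcases hx e with h | h <;> rw [h]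
      exacts [hp e, hq e]
    refine ⟨a, ha, ?_⟩
    rw [sum_filter_fiberwise_eq, sum_filter_netOutflow]
    have hS := hcut S x hxmem
    rw [Finset.sum_congr rfl fun e _ => setIntegral_cutSet (hf.isL1 e) S (hxmem e), cutSize,
      Finset.sum_add_distrib, ← le_sub_iff_add_le, ← Finset.sum_sub_distrib] at hS
    simpa only [hax, mul_comm] using hS
  refine ⟨_, isXK_of_netOutflow_eq hf hflow, fun e x hx => abs_le.2 ⟨?_, ?_⟩⟩
  · linarith [ha.1 e, isMinOn_iff.1 (hmin e) x hx]
  · linarith [ha.2 e, isMaxOn_iff.1 (hmax e) x hx]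

end MaxFlowMinCut

section Pieces

variable {V E : Type*} (Γ : MetricGraph V E)

/-- The coordinates of families of points, one on each closed edge. -/
def box : Set (E → ℝ) := univ.pi fun e => Icc 0 (Γ.len e)

open Classical in
/-- The interval `(p, q)` in the edge `e₀`, as a subset of the graph. -/
def arc (e₀ : E) (p q : ℝ) (e : E) : Set ℝ := if e = e₀ then Ioo p q else ∅

/-- The competitors that suffice to determine the Cheeger constant: the sets cut out by `S` and one
point per edge, and the arcs issuing from the initial end of an edge. -/
def piece : Set V ⊕ E → (E → ℝ) → E → Set ℝ
  | .inl S, x => Γ.cutSet S x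
  | .inr e, x => arc e 0 (x e)

variable {Γ}

theorem cutSet_eq_Ioo (S : Set V) {x : E → ℝ} (hx : x ∈ Γ.box) (e : E) :
    ∃ p q, 0 ≤ p ∧ p ≤ q ∧ q ≤ Γ.len e ∧ Γ.cutSet S x e = Ioo p q := by
  refine ⟨_, _, ?_, ?_, ?_, rfl⟩ <;> have := hx e (mem_univ e) <;> have := Γ.len_pos e <;>
    split_ifs <;> simp_all [le_of_lt]

theorem arc_eq_Ioo (e₀ : E) {p q : ℝ} (hp : 0 ≤ p) (hpq : p ≤ q) (hq : q ≤ Γ.len e₀) (e : E) :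
    ∃ p' q', 0 ≤ p' ∧ p' ≤ q' ∧ q' ≤ Γ.len e ∧ arc e₀ p q e = Ioo p' q' := by
  by_cases he : e = e₀
  · subst he
    exact ⟨p, q, hp, hpq, hq, if_pos rfl⟩
  · exact ⟨0, 0, le_rfl, le_rfl, (Γ.len_pos e).le, by simp [arc, he]⟩

theorem piece_eq_Ioo (k : Set V ⊕ E) {x : E → ℝ} (hx : x ∈ Γ.box) (e : E) :
    ∃ p q, 0 ≤ p ∧ p ≤ q ∧ q ≤ Γ.len e ∧ Γ.piece k x e = Ioo p q := by
  cases k with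
  | inl S => exact cutSet_eq_Ioo S hx e
  | inr e₀ => exact arc_eq_Ioo e₀ le_rfl (hx e₀ (mem_univ _)).1 (hx e₀ (mem_univ _)).2 e

theorem finitePerimeter_of_eq_Ioo {D : E → Set ℝ}
    (hD : ∀ e, ∃ p q, 0 ≤ p ∧ p ≤ q ∧ q ≤ Γ.len e ∧ D e = Ioo p q) : Γ.FinitePerimeter D :=
  fun e => by
    obtain ⟨p, q, hp, hpq, hq, h⟩ := hD e
    rw [chi, h]
    exact IsBVOn.indicator_Ioo hp hpq hq

variable [Fintype E]

theorem integral_chi_mul_of_eq_Ioo {D : E → Set ℝ}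
    (hD : ∀ e, ∃ p q, 0 ≤ p ∧ p ≤ q ∧ q ≤ Γ.len e ∧ D e = Ioo p q) (f : E → ℝ → ℝ) :
    Γ.integral (fun e x => chi D e x * f e x) = ∑ e, ∫ x in D e, f e x :=
  Finset.sum_congr rfl fun e _ => by
    obtain ⟨p, q, hp, -, hq, h⟩ := hD e
    have hsub : Γ.edge e ∩ D e = D e := inter_eq_right.2 (h ▸ Ioo_subset_Ioo hp hq)
    have hmeas : MeasurableSet (D e) := h ▸ measurableSet_Ioo
    rw [← hsub, ← setIntegral_indicator hmeas]
    simp [chi, indicator]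

theorem integral_chi_arc_mul {e₀ : E} {p q : ℝ} (hp : 0 ≤ p) (hpq : p ≤ q) (hq : q ≤ Γ.len e₀)
    (f : E → ℝ → ℝ) :
    Γ.integral (fun e x => chi (arc e₀ p q) e x * f e x) = ∫ x in p..q, f e₀ x := by
  rw [integral_chi_mul_of_eq_Ioo (arc_eq_Ioo e₀ hp hpq hq), Finset.sum_eq_single e₀,
    arc, if_pos rfl, setIntegral_Ioo_eq_intervalIntegral hpq]
  · exact fun e _ he => by simp [arc, he]
  · simp

theorem length_eq_sum_setIntegral_one {D : E → Set ℝ}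
    (hD : ∀ e, ∃ p q, 0 ≤ p ∧ p ≤ q ∧ q ≤ Γ.len e ∧ D e = Ioo p q) :
    Γ.length D = ∑ e, ∫ _ in D e, (1 : ℝ) := by
  rw [length_eq_integral_chi (finitePerimeter_of_eq_Ioo hD).isL1]
  simpa using integral_chi_mul_of_eq_Ioo hD (fun _ _ => 1)

theorem length_arc {e₀ : E} {p q : ℝ} (hp : 0 ≤ p) (hpq : p ≤ q) (hq : q ≤ Γ.len e₀) :
    Γ.length (arc e₀ p q) = q - p := by
  rw [length_eq_integral_chi (finitePerimeter_of_eq_Ioo (arc_eq_Ioo e₀ hp hpq hq)).isL1]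
  simpa using integral_chi_arc_mul hp hpq hq (fun _ _ => 1)

theorem length_cutSet (S : Set V) {x : E → ℝ} (hx : x ∈ Γ.box) :
    Γ.length (Γ.cutSet S x) = ∑ e, (S.indicator 1 (Γ.ter e) * Γ.len e +
      (S.indicator 1 (Γ.ini e) - S.indicator 1 (Γ.ter e)) * x e) := by
  rw [length_eq_sum_setIntegral_one (cutSet_eq_Ioo S hx)]
  refine Finset.sum_congr rfl fun e _ => ?_
  rw [setIntegral_cutSet (integrable_const (1 : ℝ)) S (hx e (mem_univ e))]
  simp

theorem continuousOn_length_piece (k : Set V ⊕ E) :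
    ContinuousOn (fun x => Γ.length (Γ.piece k x)) Γ.box := by
  cases k with
  | inl S =>
    refine ContinuousOn.congr (Continuous.continuousOn ?_) fun x hx => length_cutSet S hx
    fun_prop
  | inr e =>
    refine (continuous_apply e).continuousOn.congr fun x hx => ?_
    have hxe := hx e (mem_univ e)
    exact (length_arc le_rfl hxe.1 hxe.2).trans (sub_zero _)

theorem per_arc_le [Finite V] {e₀ : E} {p q : ℝ} (hp : 0 ≤ p) (hpq : p ≤ q) (hq : q ≤ Γ.len e₀) :
    Γ.Per (arc e₀ p q) ≤ 2 :=
  TV_le fun z dz hz => by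
    rw [integral_chi_arc_mul hp hpq hq, ← hz.1.sub_eq_integral e₀ ⟨hp, hpq.trans hq⟩
      ⟨hp.trans hpq, hq⟩]
    linarith [(abs_le.1 (hz.2 e₀ p ⟨hp, hpq.trans hq⟩)).1,
      (abs_le.1 (hz.2 e₀ q ⟨hp.trans hpq, hq⟩)).2]

theorem per_cutSet_le [Finite V] (S : Set V) {x : E → ℝ} (hx : x ∈ Γ.box) :
    Γ.Per (Γ.cutSet S x) ≤ Γ.cutSize S :=
  TV_le fun z dz hz => by
    have hkirchhoff := (isXK_iff.1 hz.1).2 (S.indicator 1)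
    rw [Fintype.sum_prod_type] at hkirchhoff
    rw [integral_chi_mul_of_eq_Ioo (cutSet_eq_Ioo S hx), ← sub_zero (∑ e, _), ← hkirchhoff,
      ← Finset.sum_sub_distrib, cutSize]
    refine Finset.sum_le_sum fun e _ => ?_
    have hle := (Γ.len_pos e).le
    have hxe := hx e (mem_univ e)
    rw [setIntegral_cutSet (hz.1.isL2_deriv.isL1 e) S hxe,
      ← hz.1.sub_eq_integral e (left_mem_Icc.2 hle) (right_mem_Icc.2 hle),
      ← hz.1.sub_eq_integral e (left_mem_Icc.2 hle) hxe]
    refine le_trans (le_of_eq ?_) ((le_abs_self _).trans ((abs_mul _ (z e (x e))).trans_le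
      (mul_le_of_le_one_right (abs_nonneg _) (hz.2 e _ hxe))))
    simp only [Fintype.sum_bool, endVertex, endFlux, if_true, Bool.false_eq_true, if_false]
    ring

variable (Γ) in
/-- The number of cuts that separate a piece from its complement; an upper bound for its
perimeter. -/
def pieceSize : Set V ⊕ E → ℝ
  | .inl S => Γ.cutSize S
  | .inr _ => 2

theorem per_piece_le [Finite V] (k : Set V ⊕ E) {x : E → ℝ} (hx : x ∈ Γ.box) :
    Γ.Per (Γ.piece k x) ≤ Γ.pieceSize k := by
  cases k with
  | inl S => exact per_cutSet_le S hx
  | inr e => exact per_arc_le le_rfl (hx e (mem_univ e)).1 (hx e (mem_univ e)).2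

end Pieces

section Signs

variable {V E : Type*} {Γ : MetricGraph V E} {u ξ : E → ℝ → ℝ}

theorem mem_signSet_iff {a s : ℝ} : s ∈ signSet a ↔ |s| ≤ 1 ∧ a * s = |a| := by
  rcases lt_trichotomy a 0 with ha | rfl | ha
  · rw [signSet, if_neg ha.not_gt, if_pos ha, mem_singleton_iff, abs_of_neg ha]
    exact ⟨by rintro rfl; simp, fun h => by nlinarith [h.2]⟩
  · simp [signSet, abs_le]
  · rw [signSet, if_pos ha, mem_singleton_iff, abs_of_pos ha]
    exact ⟨by rintro rfl; simp, fun h => by nlinarith [h.2]⟩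

theorem superlevel_neg_zero (u : E → ℝ → ℝ) : Γ.superlevel (-u) 0 = Γ.sublevel u 0 := by
  funext e
  simp [superlevel, sublevel]

theorem sublevel_neg_zero (u : E → ℝ → ℝ) : Γ.sublevel (-u) 0 = Γ.superlevel u 0 := by
  funext e
  simp [superlevel, sublevel]

variable [Fintype E]

variable (Γ) in
/-- The measurable functions with values in `[-1, 1]` and mean zero. Multiplied by the Cheeger
constant, they are the derivatives of the fields that calibrate the total variation. -/
structure IsBalanced (ξ : E → ℝ → ℝ) : Prop where
  isLInfty : Γ.IsLInfty ξ
  ae_abs_le_one : ∀ e, ∀ᵐ x ∂volume.restrict (Γ.edge e), |ξ e x| ≤ 1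
  integral_eq_zero : Γ.integral ξ = 0

theorem IsBalanced.neg (h : Γ.IsBalanced ξ) : Γ.IsBalanced fun e x => -ξ e x where
  isLInfty e := (h.isLInfty e).neg
  ae_abs_le_one := by simpa only [abs_neg] using h.ae_abs_le_one
  integral_eq_zero := by rw [integral_neg, h.integral_eq_zero, neg_zero]

theorem integral_mul_eq_norm1 (h : ∀ e, ∀ x ∈ Γ.edge e, ξ e x ∈ signSet (u e x)) :
    Γ.integral (fun e x => u e x * ξ e x) = Γ.norm1 u :=
  integral_congr fun e => by
    filter_upwards [ae_restrict_mem (Γ.measurableSet_edge e)] with x hx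
      using (mem_signSet_iff.1 (h e x hx)).2

theorem exists_balancing_value {p n T : ℝ} (hp : p ≤ T / 2) (hn : n ≤ T / 2) :
    ∃ κ : ℝ, |κ| ≤ 1 ∧ p - n + κ * (T - p - n) = 0 := by
  rcases (show 0 ≤ T - p - n by linarith).eq_or_lt with h | h
  · exact ⟨0, by simp, by linarith⟩
  · refine ⟨(n - p) / (T - p - n), ?_, by field_simp; ring⟩
    rw [abs_div, abs_of_pos h, div_le_one h]
    exact abs_le.2 ⟨by linarith, by linarith⟩

/-- The zero set of `u` leaves room to balance the signs on the rest of the graph. -/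
theorem IsMedian.exists_isBalanced (hu : Γ.IsL1 u) (hm : Γ.IsMedian u 0) :
    ∃ ξ, Γ.IsBalanced ξ ∧ ∀ e, ∀ x ∈ Γ.edge e, ξ e x ∈ signSet (u e x) := by
  have hP := isL1_chi_superlevel hu 0
  have hN : Γ.IsL1 (chi (Γ.sublevel u 0)) :=
    superlevel_neg_zero (Γ := Γ) u ▸ isL1_chi_superlevel (fun e => (hu e).neg) 0
  obtain ⟨κ, hκ, hbalance⟩ := exists_balancing_value hm.2 hm.1
  set ξ : E → ℝ → ℝ := fun e x =>
    (1 - κ) * chi (Γ.superlevel u 0) e x + (-1 - κ) * chi (Γ.sublevel u 0) e x + κ with hξ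
  have hsign : ∀ e, ∀ x ∈ Γ.edge e, ξ e x ∈ signSet (u e x) := fun e x hx => by
    rcases lt_trichotomy (u e x) 0 with h | h | h
    · simp [hξ, chi, superlevel, sublevel, signSet, hx, h, h.not_gt]
    · simpa [hξ, chi, superlevel, sublevel, signSet, h] using abs_le.1 hκ
    · simp [hξ, chi, superlevel, sublevel, signSet, hx, h, h.not_gt]
  have hPN := (hP.const_mul (1 - κ)).add (hN.const_mul (-1 - κ))
  have hbdd : ∀ e, ∀ᵐ x ∂volume.restrict (Γ.edge e), |ξ e x| ≤ 1 := fun e => by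
    filter_upwards [ae_restrict_mem (Γ.measurableSet_edge e)] with x hx
      using (mem_signSet_iff.1 (hsign e x hx)).1
  refine ⟨ξ, ⟨fun e => memLp_top_of_bound ((hPN e).1.add aestronglyMeasurable_const) 1 (hbdd e),
    hbdd, ?_⟩, hsign⟩
  rw [hξ, integral_add hPN fun e => integrable_const κ,
    integral_add (hP.const_mul _) (hN.const_mul _), integral_const_mul, integral_const_mul,
    integral_const, ← length_eq_integral_chi hP, ← length_eq_integral_chi hN]
  linarith

end Signs

section Calibration

variable {V E : Type*} [Fintype E] {Γ : MetricGraph V E} {u ξ : E → ℝ → ℝ} {D : E → Set ℝ}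

variable (Γ) in
/-- The smaller one of `ℓ(D)` and `ℓ(Γ) - ℓ(D)`. -/
def minLength (D : E → Set ℝ) : ℝ := min (Γ.length D) (Γ.totalLength - Γ.length D)

theorem IsBalanced.integral_chi_mul_le (hξ : Γ.IsBalanced ξ) (hD : Γ.IsL1 (chi D)) :
    Γ.integral (fun e x => chi D e x * ξ e x) ≤ Γ.minLength D := by
  have hξ1 := hξ.isLInfty.isL2.isL1
  have hmul := hξ1.isLInfty_mul (isLInfty_chi hD)
  have hchi : ∀ e x, chi D e x = 0 ∨ chi D e x = 1 := fun e x => by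
    by_cases hx : x ∈ D e <;> simp [chi, hx]
  refine le_min ?_ ?_
  · rw [length_eq_integral_chi hD]
    refine integral_mono hmul hD fun e => ?_
    filter_upwards [hξ.ae_abs_le_one e] with x hx
    rcases hchi e x with h | h <;> simp [h, (abs_le.1 hx).2]
  · have hrest : Γ.IsL1 fun e x => -1 * chi D e x + 1 := fun e =>
      ((hD.const_mul (-1)) e).add (integrable_const 1)
    calc Γ.integral (fun e x => chi D e x * ξ e x)
        ≤ Γ.integral fun e x => ξ e x + (-1 * chi D e x + 1) := by
          refine integral_mono hmul (hξ1.add hrest) fun e => ?_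
          filter_upwards [hξ.ae_abs_le_one e] with x hx
          rcases hchi e x with h | h <;> simp [h]
          linarith [(abs_le.1 hx).1]
      _ = Γ.totalLength - Γ.length D := by
          rw [integral_add hξ1 hrest, hξ.integral_eq_zero, zero_add,
            ← integral_congr (ae_chi_compl D), ← length_compl hD, length_eq_integral_chi]
          exact fun e => (hrest e).congr ((ae_chi_compl D e).mono fun _ h => h.symm)

theorem IsBalanced.intervalIntegral_le (hξ : Γ.IsBalanced ξ) {e : E} {x y : ℝ}
    (hx : x ∈ Icc 0 (Γ.len e)) (hy : y ∈ Icc 0 (Γ.len e)) :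
    ∫ s in x..y, ξ e s ≤ min |y - x| (Γ.totalLength - |y - x|) := by
  wlog hxy : x ≤ y generalizing x y ξ
  · rw [intervalIntegral.integral_symm, ← intervalIntegral.integral_neg, abs_sub_comm]
    exact this hξ.neg hy hx (le_of_not_ge hxy)
  · have hle := hξ.integral_chi_mul_le
      (finitePerimeter_of_eq_Ioo (arc_eq_Ioo e hx.1 hxy hy.2)).isL1
    rwa [minLength, length_arc hx.1 hxy hy.2, integral_chi_arc_mul hx.1 hxy hy.2,
      ← abs_of_nonneg (sub_nonneg.2 hxy)] at hle

theorem continuousOn_minLength_piece (k : Set V ⊕ E) :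
    ContinuousOn (fun x => Γ.minLength (Γ.piece k x)) Γ.box :=
  have hcont := continuousOn_length_piece k
  ContinuousOn.inf hcont (continuousOn_const.sub hcont)

theorem minLength_piece_inr {e : E} {x : E → ℝ} (hx : x ∈ Γ.box) :
    Γ.minLength (Γ.piece (.inr e) x) = min (x e) (Γ.totalLength - x e) := by
  rw [minLength, piece, length_arc le_rfl (hx e (mem_univ e)).1 (hx e (mem_univ e)).2, sub_zero]

theorem IsBalanced.exists_isAdmissible_of_mul_minLength_le [Finite V] {c : ℝ} (hc : 0 ≤ c)
    (hpiece : ∀ k, ∀ x ∈ Γ.box, c * Γ.minLength (Γ.piece k x) ≤ Γ.pieceSize k)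
    (hξ : Γ.IsBalanced ξ) : ∃ z, Γ.IsAdmissible z fun e x => c * ξ e x := by
  refine exists_isAdmissible_of_cut (fun e => (hξ.isLInfty.isL2 e).const_mul c) ?_
    (fun e x hx y hy => ?_) fun S x hx => ?_
  · rw [integral_const_mul, hξ.integral_eq_zero, mul_zero]
  · have hyx : |y - x| ≤ Γ.len e := abs_le.2 ⟨by linarith [hx.2, hy.1], by linarith [hx.1, hy.2]⟩
    classical
    have hbox : (fun e' => if e' = e then |y - x| else 0) ∈ Γ.box := fun e' _ => by
      dsimp only
      split_ifs with h
      · exact ⟨abs_nonneg _, h ▸ hyx⟩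
      · exact ⟨le_rfl, (Γ.len_pos e').le⟩
    rw [intervalIntegral.integral_const_mul]
    refine (mul_le_mul_of_nonneg_left (hξ.intervalIntegral_le hx hy) hc).trans ?_
    simpa [minLength_piece_inr hbox, pieceSize] using hpiece (.inr e) _ hbox
  · have hx' : x ∈ Γ.box := fun e _ => hx e
    have hcut := cutSet_eq_Ioo S hx'
    simp only [MeasureTheory.integral_const_mul, ← Finset.mul_sum]
    rw [← integral_chi_mul_of_eq_Ioo hcut]
    have hle := hξ.integral_chi_mul_le (finitePerimeter_of_eq_Ioo hcut).isL1
    exact (mul_le_mul_of_nonneg_left hle hc).trans (hpiece (.inl S) x hx')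

theorem eq_empty_or_univ_of_cutSize_eq_zero {S : Set V} (h : Γ.cutSize S = 0) :
    S = ∅ ∨ S = univ := by
  have hedge : ∀ e, Γ.ini e ∈ S ↔ Γ.ter e ∈ S := fun e => by
    have he := (Finset.sum_eq_zero_iff_of_nonneg fun e _ => abs_nonneg _).1 h e (Finset.mem_univ e)
    by_cases hini : Γ.ini e ∈ S <;> by_cases hter : Γ.ter e ∈ S <;> simp_all
  have hadj : ∀ v w, (SimpleGraph.fromRel fun v w => ∃ e, Γ.ini e = v ∧ Γ.ter e = w).Adj v w →
      (v ∈ S ↔ w ∈ S) := by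
    rintro v w ⟨-, ⟨e, rfl, rfl⟩ | ⟨e, rfl, rfl⟩⟩
    exacts [hedge e, (hedge e).symm]
  have hiff : ∀ v w, v ∈ S ↔ w ∈ S := fun v w => by
    obtain ⟨p⟩ := Γ.connected.preconnected v w
    induction p with
    | nil => rfl
    | cons hvw _ ih => exact (hadj _ _ hvw).trans ih
  refine S.eq_empty_or_nonempty.imp_right fun ⟨v, hv⟩ => eq_univ_of_forall fun w => (hiff v w).1 hv

theorem minLength_piece_eq_zero {k : Set V ⊕ E} (hk : Γ.pieceSize k = 0) {x : E → ℝ}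
    (hx : x ∈ Γ.box) : Γ.minLength (Γ.piece k x) = 0 := by
  have hT := Γ.totalLength_nonneg
  cases k with
  | inl S =>
    rw [minLength, piece, length_cutSet S hx]
    rcases eq_empty_or_univ_of_cutSize_eq_zero hk with rfl | rfl
    · simpa using hT
    · simpa [totalLength] using hT
  | inr e => simp [pieceSize] at hk

theorem pieceSize_nonneg (k : Set V ⊕ E) : 0 ≤ Γ.pieceSize k := by
  cases k with
  | inl S => exact Finset.sum_nonneg fun _ _ => abs_nonneg _
  | inr e => exact zero_le_two

theorem exists_minLength_piece_pos [Nonempty E] :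
    ∃ k, ∃ x ∈ Γ.box, 0 < Γ.minLength (Γ.piece k x) := by
  inhabit E
  have hx : (fun e => Γ.len e / 2) ∈ Γ.box := fun e _ => by
    constructor <;> linarith [Γ.len_pos e]
  refine ⟨.inr default, _, hx, ?_⟩
  have hlen : Γ.len default ≤ Γ.totalLength :=
    Finset.single_le_sum (fun e _ => (Γ.len_pos e).le) (Finset.mem_univ _)
  rw [minLength_piece_inr hx]
  exact lt_min (half_pos (Γ.len_pos _)) (by linarith [Γ.len_pos default])

theorem exists_optimal_piece [Finite V] [Nonempty E] : ∃ c : ℝ, 0 < c ∧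
    (∀ k, ∀ x ∈ Γ.box, c * Γ.minLength (Γ.piece k x) ≤ Γ.pieceSize k) ∧
    ∃ k, ∃ x ∈ Γ.box, 0 < Γ.minLength (Γ.piece k x) ∧
      Γ.pieceSize k = c * Γ.minLength (Γ.piece k x) := by
  have hcompact : IsCompact Γ.box := isCompact_univ_pi fun e => isCompact_Icc
  have hne : Γ.box.Nonempty := univ_pi_nonempty_iff.2 fun e => nonempty_Icc.2 (Γ.len_pos e).le
  choose y hy hmax using fun k =>
    hcompact.exists_isMaxOn hne (continuousOn_minLength_piece (Γ := Γ) k)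
  have hratio : ∀ k, ∀ x ∈ Γ.box, Γ.minLength (Γ.piece k x) ≤
      Γ.minLength (Γ.piece k (y k)) / Γ.pieceSize k * Γ.pieceSize k := fun k x hx => by
    by_cases hk : Γ.pieceSize k = 0
    · rw [minLength_piece_eq_zero hk hx, hk, mul_zero]
    · rw [div_mul_cancel₀ _ hk]
      exact hmax k hx
  obtain ⟨k₁, x₁, hx₁, hpos₁⟩ := Γ.exists_minLength_piece_pos
  have : Nonempty (Set V ⊕ E) := ⟨k₁⟩
  obtain ⟨k₀, hk₀⟩ := Finite.exists_max fun k => Γ.minLength (Γ.piece k (y k)) / Γ.pieceSize k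
  set M := Γ.minLength (Γ.piece k₀ (y k₀)) / Γ.pieceSize k₀
  have hle : ∀ k, ∀ x ∈ Γ.box, Γ.minLength (Γ.piece k x) ≤ M * Γ.pieceSize k := fun k x hx =>
    (hratio k x hx).trans (mul_le_mul_of_nonneg_right (hk₀ k) (pieceSize_nonneg k))
  have hM : 0 < M := pos_of_mul_pos_left (hpos₁.trans_le (hle k₁ x₁ hx₁)) (pieceSize_nonneg k₁)
  refine ⟨M⁻¹, inv_pos.2 hM, fun k x hx => (inv_mul_le_iff₀ hM).2 (hle k x hx), k₀, y k₀, hy k₀, ?_⟩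
  have hk₀ : Γ.pieceSize k₀ ≠ 0 := fun h => hM.ne' (by simp only [M, h, div_zero])
  have heq : Γ.minLength (Γ.piece k₀ (y k₀)) = M * Γ.pieceSize k₀ := (div_mul_cancel₀ _ hk₀).symm
  rw [heq, inv_mul_cancel_left₀ hM.ne']
  exact ⟨mul_pos hM ((pieceSize_nonneg k₀).lt_of_ne' hk₀), rfl⟩

theorem FinitePerimeter.exists_length_eq_minLength [Finite V] (hD : Γ.FinitePerimeter D) :
    ∃ D', Γ.FinitePerimeter D' ∧ Γ.length D' ≤ Γ.totalLength / 2 ∧ Γ.Per D' = Γ.Per D ∧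
      Γ.length D' = Γ.minLength D := by
  rcases le_total (Γ.length D) (Γ.totalLength / 2) with h | h
  · exact ⟨D, hD, h, rfl, (min_eq_left (by linarith)).symm⟩
  · have hcompl := length_compl hD.isL1
    exact ⟨Γ.compl D, hD.compl, by linarith, hD.per_compl,
      hcompl.trans (min_eq_right (by linarith)).symm⟩

/-- A calibration `z` of `χ_D` has derivative `c` on `D`. -/
theorem FinitePerimeter.mul_length_le_per {c : ℝ}
    (hcal : ∀ ξ, Γ.IsBalanced ξ → ∃ z, Γ.IsAdmissible z fun e x => c * ξ e x)
    (hD : Γ.FinitePerimeter D) (hle : Γ.length D ≤ Γ.totalLength / 2) :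
    c * Γ.length D ≤ Γ.Per D := by
  obtain ⟨ξ, hξ, hsign⟩ := (isMedian_const_mul_chi one_pos hle).exists_isBalanced
    (hD.isL1.const_mul 1)
  obtain ⟨z, hz⟩ := hcal ξ hξ
  have hnorm := integral_mul_eq_norm1 hsign
  rw [hD.norm1_const_mul_chi zero_le_one] at hnorm
  simp only [one_mul] at hnorm
  rw [← hnorm, ← integral_const_mul]
  simpa only [Per, mul_left_comm] using hD.integral_mul_le_TV hz

theorem exists_calibration_constant [Finite V] [Nonempty E] : ∃ c : ℝ, 0 < c ∧
    (∀ ξ, Γ.IsBalanced ξ → ∃ z, Γ.IsAdmissible z fun e x => c * ξ e x) ∧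
    Γ.cheeger = c ∧ ∃ D, Γ.IsCheegerCut D := by
  obtain ⟨c, hc, hpiece, k, x, hx, hpos, hsize⟩ := Γ.exists_optimal_piece
  have hcal := fun ξ (hξ : Γ.IsBalanced ξ) =>
    hξ.exists_isAdmissible_of_mul_minLength_le hc.le hpiece
  obtain ⟨D, hD, hle, hper, hlen⟩ :=
    (finitePerimeter_of_eq_Ioo (piece_eq_Ioo k hx)).exists_length_eq_minLength
  have hperle : Γ.Per D ≤ c * Γ.length D := by
    rw [hper, hlen, ← hsize]
    exact per_piece_le k hx
  have hD0 : 0 < Γ.length D := hlen ▸ hpos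
  have hlower := fun D' (hD' : Γ.FinitePerimeter D') => hD'.mul_length_le_per hcal
  have hcheeger := cheeger_eq_of_forall_mul_length_le_per hlower hD hD0 hle hperle
  refine ⟨c, hc, hcal, hcheeger, D, hD, hD0, hle, ?_⟩
  rw [hcheeger, eq_div_iff hD0.ne']
  exact (hlower D hD hle).antisymm hperle

variable (Γ)

theorem cheeger_pos [Finite V] [Nonempty E] : 0 < Γ.cheeger := by
  obtain ⟨c, hc, -, rfl, -⟩ := exists_calibration_constant (Γ := Γ)
  exact hc

theorem exists_isCheegerCut [Finite V] [Nonempty E] : ∃ D, Γ.IsCheegerCut D := by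
  obtain ⟨-, -, -, -, hD⟩ := exists_calibration_constant (Γ := Γ)
  exact hD

variable {Γ}

theorem IsBalanced.exists_isAdmissible [Finite V] [Nonempty E] (hξ : Γ.IsBalanced ξ) :
    ∃ z, Γ.IsAdmissible z fun e x => Γ.cheeger * ξ e x := by
  obtain ⟨c, -, hcal, rfl, -⟩ := exists_calibration_constant (Γ := Γ)
  exact hcal ξ hξ

end Calibration

section Eigenpairs

variable {V E : Type*} [Fintype E] {Γ : MetricGraph V E} {u v w z dz : E → ℝ → ℝ} {lam : ℝ}
  {D : E → Set ℝ}

theorem isSubgradient_of_isAdmissible (hu : Γ.IsBV u) (hz : Γ.IsAdmissible z dz)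
    (hle : Γ.TV u ≤ Γ.integral fun e x => u e x * dz e x) : Γ.IsSubgradient u dz := by
  have hdz := hz.1.isL2_deriv
  refine ⟨hu.isLInfty.isL2, hdz, fun w _ => ?_⟩
  by_cases hw : Γ.IsBV w
  · rw [hu.energy_eq, hw.energy_eq, ← EReal.coe_add, EReal.coe_le_coe_iff]
    simp only [mul_comm (dz _ _), sub_mul]
    rw [integral_sub (hdz.isL1.isLInfty_mul hw.isLInfty) (hdz.isL1.isLInfty_mul hu.isLInfty)]
    linarith [hw.integral_mul_le_TV hz]
  · rw [show Γ.energy w = ⊤ from if_neg hw]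
    exact le_top

theorem IsSubgradient.TV_add_integral_le (h : Γ.IsSubgradient u v) (hu : Γ.IsBV u)
    (hw : Γ.IsBV w) :
    Γ.TV u + Γ.integral (fun e x => v e x * (w e x - u e x)) ≤ Γ.TV w := by
  have hle := h.2.2 w hw.isLInfty.isL2
  rwa [hu.energy_eq, hw.energy_eq, ← EReal.coe_add, EReal.coe_le_coe_iff] at hle

theorem IsSubgradient.TV_le_integral_mul [Finite V] (h : Γ.IsSubgradient u v) (hu : Γ.IsBV u) :
    Γ.TV u ≤ Γ.integral fun e x => u e x * v e x := by
  have hzero : Γ.IsBV 0 := fun e => IsBVOn.const (Γ.len_pos e).le 0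
  have hTV : Γ.TV 0 ≤ 0 := TV_le fun z dz _ => by simp [integral]
  have hle := h.TV_add_integral_le hu hzero
  simp only [Pi.zero_apply, zero_sub, mul_comm (v _ _), neg_mul, integral_neg] at hle
  linarith

/-- Adding constants to `u` does not change its total variation. -/
theorem IsSubgradient.integral_eq_zero [Finite V] (h : Γ.IsSubgradient u v) (hu : Γ.IsBV u) :
    Γ.integral v = 0 := by
  have hconst : ∀ c : ℝ, c * Γ.integral v ≤ 0 := fun c => by
    have hle := h.TV_add_integral_le hu fun e => (hu e).add (IsBVOn.const (Γ.len_pos e).le c)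
    rw [hu.TV_add_const] at hle
    simp only [add_sub_cancel_left, mul_comm (v _ _), integral_const_mul] at hle
    linarith
  linarith [hconst 1, hconst (-1)]

theorem integral_mul_const_mul_eq {ξ : E → ℝ → ℝ}
    (hsign : ∀ e, ∀ x ∈ Γ.edge e, ξ e x ∈ signSet (u e x)) (hnorm : Γ.norm1 u = 1) (c : ℝ) :
    Γ.integral (fun e x => u e x * (c * ξ e x)) = c := by
  simp only [mul_left_comm (u _ _)]
  rw [integral_const_mul, integral_mul_eq_norm1 hsign, hnorm, mul_one]

theorem IsEigenpair.isBalanced [Finite V] (hlam : lam ≠ 0) (h : Γ.IsEigenpair lam u) :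
    ∃ ξ, Γ.IsBalanced ξ ∧ (∀ e, ∀ x ∈ Γ.edge e, ξ e x ∈ signSet (u e x)) ∧
      Γ.IsSubgradient u fun e x => lam * ξ e x := by
  obtain ⟨hu, -, ξ, hsign, hsub⟩ := h
  have hbdd : ∀ e, ∀ᵐ x ∂volume.restrict (Γ.edge e), |ξ e x| ≤ 1 := fun e => by
    filter_upwards [ae_restrict_mem (Γ.measurableSet_edge e)] with x hx
      using (mem_signSet_iff.1 (hsign e x hx)).1
  have hmean := hsub.integral_eq_zero hu
  rw [integral_const_mul] at hmean
  refine ⟨ξ, ⟨fun e => memLp_top_of_bound ?_ 1 (hbdd e), hbdd,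
    (mul_eq_zero.1 hmean).resolve_left hlam⟩, hsign, hsub⟩
  simpa [inv_mul_cancel_left₀ hlam] using (hsub.2.1 e).1.const_mul lam⁻¹

variable [Finite V] [Nonempty E]

/-- A calibration of `u` shows `h(Γ) ≤ TV(u)`, and `TV(u) ≤ lam` since `lam * ξ` is a
subgradient. -/
theorem IsEigenpair.cheeger_le (hlam : lam ≠ 0) (h : Γ.IsEigenpair lam u) : Γ.cheeger ≤ lam := by
  obtain ⟨ξ, hξ, hsign, hsub⟩ := h.isBalanced hlam
  obtain ⟨z, hz⟩ := hξ.exists_isAdmissible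
  calc Γ.cheeger = Γ.integral fun e x => u e x * (Γ.cheeger * ξ e x) :=
        (integral_mul_const_mul_eq hsign h.2.1 _).symm
    _ ≤ Γ.TV u := h.1.integral_mul_le_TV hz
    _ ≤ Γ.integral fun e x => u e x * (lam * ξ e x) := hsub.TV_le_integral_mul h.1
    _ = lam := integral_mul_const_mul_eq hsign h.2.1 lam

theorem exists_calibration_of_mem_competitors (hu : u ∈ Γ.competitors) :
    ∃ ξ z : E → ℝ → ℝ, (∀ e, ∀ x ∈ Γ.edge e, ξ e x ∈ signSet (u e x)) ∧
      (Γ.IsAdmissible z fun e x => Γ.cheeger * ξ e x) ∧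
      Γ.integral (fun e x => u e x * (Γ.cheeger * ξ e x)) = Γ.cheeger := by
  obtain ⟨hbv, hnorm, hmedian⟩ := hu
  obtain ⟨ξ, hξ, hsign⟩ := hmedian.exists_isBalanced hbv.isL1
  obtain ⟨z, hz⟩ := hξ.exists_isAdmissible
  exact ⟨ξ, z, hsign, hz, integral_mul_const_mul_eq hsign hnorm _⟩

theorem isEigenpair_cheeger (hu : u ∈ Γ.competitors) (hle : Γ.TV u ≤ Γ.cheeger) :
    Γ.IsEigenpair Γ.cheeger u := by
  obtain ⟨ξ, z, hsign, hz, hint⟩ := exists_calibration_of_mem_competitors hu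
  exact ⟨hu.1, hu.2.1, ξ, hsign, isSubgradient_of_isAdmissible hu.1 hz (hle.trans hint.ge)⟩

theorem IsCheegerCut.isEigenpair (hD : Γ.IsCheegerCut D) :
    Γ.IsEigenpair Γ.cheeger fun e x => 1 / Γ.length D * chi D e x :=
  isEigenpair_cheeger (hD.1.mem_competitors hD.2.1 hD.2.2.1) <| by
    rw [TV_inv_length_mul_chi, ← hD.2.2.2]

theorem isLeast_cheeger : IsLeast {lam : ℝ | lam ≠ 0 ∧ Γ.IsEigenvalue lam} Γ.cheeger := by
  obtain ⟨D, hD⟩ := exists_isCheegerCut Γ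
  exact ⟨⟨(cheeger_pos Γ).ne', _, hD.isEigenpair⟩, fun lam ⟨hlam, u, hu⟩ => hu.cheeger_le hlam⟩

theorem IsMinimizer.TV_le_cheeger (hu : Γ.IsMinimizer u) : Γ.TV u ≤ Γ.cheeger := by
  obtain ⟨D, hD, hpos, hle, hcheeger⟩ := exists_isCheegerCut Γ
  rw [hcheeger, ← TV_inv_length_mul_chi]
  exact hu.2 _ (hD.mem_competitors hpos hle)

end Eigenpairs

section Calibrations

variable {V E : Type*} [Fintype E] {Γ : MetricGraph V E} {u z dz q dq : E → ℝ → ℝ}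

variable (Γ) in
/-- The field `z`, with derivative `dz`, attains the total variation of `u`. -/
structure IsCalibration (u z dz : E → ℝ → ℝ) : Prop where
  isAdmissible : Γ.IsAdmissible z dz
  integral_le : ∀ w dw, Γ.IsAdmissible w dw →
    Γ.integral (fun e x => u e x * dw e x) ≤ Γ.integral fun e x => u e x * dz e x

theorem IsCalibration.neg [Finite V] (h : Γ.IsCalibration u z dz) :
    Γ.IsCalibration (fun e x => -u e x) (fun e x => -z e x) fun e x => -dz e x where
  isAdmissible := h.isAdmissible.neg
  integral_le w dw hw := by simpa [neg_mul, mul_neg] using h.integral_le _ _ hw.neg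

theorem IsCalibration.integral_mul_nonpos [Finite V] (h : Γ.IsCalibration u z dz)
    (hu : Γ.IsLInfty u) (hq : Γ.IsXK q dq)
    (hle : ∀ e, ∀ x ∈ Icc 0 (Γ.len e), |z e x + q e x| ≤ 1) :
    Γ.integral (fun e x => u e x * dq e x) ≤ 0 := by
  have hadd := h.integral_le _ _ ⟨h.isAdmissible.1.add_const_mul hq 1, by simpa using hle⟩
  simp only [one_mul, mul_add] at hadd
  rw [integral_add (h.isAdmissible.1.isL2_deriv.isL1.isLInfty_mul hu)
    (hq.isL2_deriv.isL1.isLInfty_mul hu)] at hadd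
  linarith

end Calibrations

section ArcFields

variable {V E : Type*} {Γ : MetricGraph V E} {i j : E × Bool} {e : E} {p q p' q' x : ℝ}

theorem integral_indicator_Ioo (hp : 0 ≤ p) (hx : 0 ≤ x) :
    ∫ s in (0 : ℝ)..x, (Ioo p q).indicator 1 s = max (min x q - p) 0 := by
  rw [intervalIntegral.integral_of_le hx, integral_Ioc_eq_integral_Ioo,
    setIntegral_indicator measurableSet_Ioo, Ioo_inter_Ioo, sup_of_le_right hp]
  simp

open Classical in
/-- The primitive of the characteristic function of the interval `(p, q)` in the edge `i.1` that
vanishes at the end of this edge opposite to `i`, so that all its flux leaves through `i`. -/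
def arcField (i : E × Bool) (p q : ℝ) (e : E) (x : ℝ) : ℝ :=
  if e = i.1 then if i.2 then max (min x q - p) 0 else -max (q - max x p) 0 else 0

theorem isW12_arcField (hp : 0 ≤ p) (hpq : p ≤ q) (hq : q ≤ Γ.len i.1) :
    Γ.IsW12 (arcField i p q) (chi (arc i.1 p q)) := by
  have harc := finitePerimeter_of_eq_Ioo (arc_eq_Ioo i.1 hp hpq hq)
  refine isW12_iff.2 ⟨(isLInfty_chi harc.isL1).isL2, fun e x hx => ?_⟩
  by_cases he : e = i.1
  · simp only [chi, arc, he, if_true, integral_indicator_Ioo hp hx.1, arcField]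
    have := hx.1
    split_ifs <;> grind
  · simp [chi, arc, arcField, he]

open Classical in
theorem endFlux_arcField (hp : 0 ≤ p) (hpq : p ≤ q) (hq : q ≤ Γ.len i.1) (k : E × Bool) :
    Γ.endFlux (arcField i p q) k = if k = i then q - p else 0 := by
  obtain ⟨e, _ | _⟩ := i <;> obtain ⟨e', _ | _⟩ := k <;> simp only [endFlux, arcField] <;> grind

variable [Fintype E]

theorem isXK_arcField_sub [Finite V] (hp : 0 ≤ p) (hpq : p ≤ q) (hq : q ≤ Γ.len i.1)
    (hp' : 0 ≤ p') (hpq' : p' ≤ q') (hq' : q' ≤ Γ.len j.1)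
    (hv : Γ.endVertex i = Γ.endVertex j) (hlen : q - p = q' - p') :
    Γ.IsXK (fun e x => arcField i p q e x + -1 * arcField j p' q' e x)
      fun e x => chi (arc i.1 p q) e x + -1 * chi (arc j.1 p' q') e x := by
  refine isXK_iff.2 ⟨(isW12_arcField hp hpq hq).add_const_mul (isW12_arcField hp' hpq' hq') _,
    fun g => ?_⟩
  simp only [endFlux_add_const_mul, endFlux_arcField hp hpq hq, endFlux_arcField hp' hpq' hq', hlen,
    mul_add, Finset.sum_add_distrib]
  simp only [mul_ite, mul_zero, Finset.sum_ite_eq', Finset.mem_univ, if_true, hv]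
  ring

theorem IsCalibration.integral_le_integral [Finite V] {u z dz : E → ℝ → ℝ}
    (h : Γ.IsCalibration u z dz) (hu : Γ.IsLInfty u) (hp : 0 ≤ p) (hpq : p ≤ q)
    (hq : q ≤ Γ.len i.1) (hp' : 0 ≤ p') (hpq' : p' ≤ q') (hq' : q' ≤ Γ.len j.1)
    (hv : Γ.endVertex i = Γ.endVertex j) (hlen : q - p = q' - p')
    (hle : ∀ e, ∀ x ∈ Icc 0 (Γ.len e),
      |z e x + (arcField i p q e x + -1 * arcField j p' q' e x)| ≤ 1) :
    ∫ x in p..q, u i.1 x ≤ ∫ x in p'..q', u j.1 x := by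
  have hi := finitePerimeter_of_eq_Ioo (arc_eq_Ioo i.1 hp hpq hq)
  have hj := finitePerimeter_of_eq_Ioo (arc_eq_Ioo j.1 hp' hpq' hq')
  have hnonpos := h.integral_mul_nonpos hu (isXK_arcField_sub hp hpq hq hp' hpq' hq' hv hlen) hle
  simp only [mul_add, mul_left_comm (u _ _) (-1)] at hnonpos
  rw [integral_add (hi.isL1.isLInfty_mul hu) ((hj.isL1.isLInfty_mul hu).const_mul _),
    integral_const_mul] at hnonpos
  simp only [mul_comm (u _ _), integral_chi_arc_mul hp hpq hq,
    integral_chi_arc_mul hp' hpq' hq'] at hnonpos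
  linarith

end ArcFields

section Exchange

open scoped Topology

variable {V E : Type*} [Fintype E] {Γ : MetricGraph V E} {u z dz : E → ℝ → ℝ} {i j : E × Bool}

theorem IsCalibration.eventually_integral_le [Finite V] (h : Γ.IsCalibration u z dz)
    (hu : Γ.IsLInfty u) {e : E} {x y : ℝ} (hx : 0 ≤ x) (hxy : x < y) (hy : y ≤ Γ.len e)
    (hlt : ∀ s ∈ Icc x y, z e s < 1) :
    ∀ᶠ r in 𝓝[>] 0, ∫ s in x..x + r, u e s ≤ ∫ s in y - r..y, u e s := by
  obtain ⟨s₀, hs₀, hmax⟩ := isCompact_Icc.exists_isMaxOn (nonempty_Icc.2 hxy.le)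
    ((h.isAdmissible.1.continuousOn e).mono (Icc_subset_Icc hx hy))
  filter_upwards [Ioo_mem_nhdsGT (sub_pos.2 hxy), Ioo_mem_nhdsGT (sub_pos.2 (hlt s₀ hs₀))]
    with r ⟨hr, hrxy⟩ ⟨_, hrlt⟩
  refine h.integral_le_integral (i := (e, true)) (j := (e, true)) hu hx (by linarith)
    (by linarith) (by linarith) (by linarith) hy rfl (by ring) fun e' s hs => ?_
  by_cases he : e' = e
  · subst he
    have hz := abs_le.1 (h.isAdmissible.2 e' s hs)
    have hle : s ∈ Icc x y → z e' s ≤ z e' s₀ := fun hs' => hmax hs'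
    simp only [arcField, if_true, mem_Icc] at hle ⊢
    rw [abs_le]
    grind
  · simpa [arcField, he] using h.isAdmissible.2 e' s hs

variable (Γ) in
/-- The two ends of the interval of length `r` in the edge `i.1` that is adjacent to its end
`i`. -/
def nearEnd (i : E × Bool) (r : ℝ) : ℝ × ℝ := if i.2 then (Γ.len i.1 - r, Γ.len i.1) else (0, r)

theorem IsCalibration.le_of_hasDerivAt [Finite V] (h : Γ.IsCalibration u z dz)
    (hu : Γ.IsLInfty u) {e : E} {x y : ℝ} (hx : 0 ≤ x) (hxy : x < y) (hy : y ≤ Γ.len e)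
    (hlt : ∀ s ∈ Icc x y, z e s < 1)
    (hdx : HasDerivAt (fun t => ∫ s in 0..t, u e s) (u e x) x)
    (hdy : HasDerivAt (fun t => ∫ s in 0..t, u e s) (u e y) y) : u e x ≤ u e y := by
  have hint : ∀ {s t : ℝ}, s ∈ Icc 0 (Γ.len e) → t ∈ Icc 0 (Γ.len e) →
      IntervalIntegrable (u e) volume s t := fun hs ht =>
    intervalIntegrable_of_integrableOn_Ioo (hu.isL2.isL1 e) hs ht
  have hleft : Filter.Tendsto (fun r : ℝ => (-r)⁻¹ • ((∫ s in 0..y + -r, u e s) -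
      ∫ s in 0..y, u e s)) (𝓝[>] 0) (𝓝 (u e y)) :=
    hdy.tendsto_slope_zero_left.comp (by simpa using tendsto_neg_nhdsGT_neg (a := (0 : ℝ)))
  refine le_of_tendsto_of_tendsto hdx.tendsto_slope_zero_right hleft ?_
  filter_upwards [h.eventually_integral_le hu hx hxy hy hlt, Ioo_mem_nhdsGT (sub_pos.2 hxy)]
    with r hr ⟨hr0, hrxy⟩
  have h0 : (0 : ℝ) ∈ Icc 0 (Γ.len e) := ⟨le_rfl, (Γ.len_pos e).le⟩
  rw [intervalIntegral.integral_interval_sub_left (hint h0 ⟨by linarith, by linarith⟩)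
    (hint h0 ⟨hx, by linarith⟩), inv_neg, neg_smul, ← smul_neg, neg_sub, ← sub_eq_add_neg,
    intervalIntegral.integral_interval_sub_left (hint h0 ⟨by linarith, hy⟩)
    (hint h0 ⟨by linarith, by linarith⟩)]
  exact smul_le_smul_of_nonneg_left hr (inv_nonneg.2 hr0.le)

/-- A function can jump only where its calibrating field has absolute value one. -/
theorem IsCalibration.eq_of_hasDerivAt [Finite V] (h : Γ.IsCalibration u z dz)
    (hu : Γ.IsLInfty u) {e : E} {x y : ℝ} (hx : x ∈ Icc 0 (Γ.len e)) (hy : y ∈ Icc 0 (Γ.len e))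
    (hlt : ∀ s ∈ uIcc x y, |z e s| < 1)
    (hdx : HasDerivAt (fun t => ∫ s in 0..t, u e s) (u e x) x)
    (hdy : HasDerivAt (fun t => ∫ s in 0..t, u e s) (u e y) y) : u e x = u e y := by
  wlog hxy : x < y generalizing x y
  · obtain rfl | hyx := (not_lt.1 hxy).eq_or_lt
    · rfl
    · exact (this hy hx (uIcc_comm x y ▸ hlt) hdy hdx hyx).symm
  rw [uIcc_of_le hxy.le] at hlt
  refine le_antisymm (h.le_of_hasDerivAt hu hx.1 hxy hy.2 (fun s hs => (abs_lt.1 (hlt s hs)).2)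
    hdx hdy) (neg_le_neg_iff.1 <| h.neg.le_of_hasDerivAt (fun e => (hu e).neg) hx.1 hxy hy.2
    (fun s hs => by linarith [(abs_lt.1 (hlt s hs)).1]) ?_ ?_)
  · simpa only [intervalIntegral.integral_neg] using hdx.fun_neg
  · simpa only [intervalIntegral.integral_neg] using hdy.fun_neg

theorem IsAdmissible.eventually_abs_add_arcField_le (hz : Γ.IsAdmissible z dz)
    (hi : Γ.endFlux z i < 1) : ∀ᶠ r in 𝓝[>] 0, ∀ e, ∀ x ∈ Icc 0 (Γ.len e),
      |z e x + arcField i (Γ.nearEnd i r).1 (Γ.nearEnd i r).2 e x| ≤ 1 := by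
  obtain ⟨M, hiM, hM⟩ := exists_between hi
  obtain ⟨δ, hδ, hclose⟩ : ∃ δ > 0, ∀ x ∈ Icc 0 (Γ.len i.1),
      |x - (if i.2 then Γ.len i.1 else 0)| < δ → (if i.2 then z i.1 x else -z i.1 x) < M := by
    have hend : (if i.2 then Γ.len i.1 else 0) ∈ Icc 0 (Γ.len i.1) := by
      split_ifs
      exacts [right_mem_Icc.2 (Γ.len_pos _).le, left_mem_Icc.2 (Γ.len_pos _).le]
    have hcont : ContinuousOn (fun x => if i.2 then z i.1 x else -z i.1 x) (Icc 0 (Γ.len i.1)) := by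
      split_ifs
      exacts [hz.1.continuousOn i.1, (hz.1.continuousOn i.1).neg]
    have hlt : (fun x => if i.2 then z i.1 x else -z i.1 x) (if i.2 then Γ.len i.1 else 0) < M := by
      simp only [endFlux] at hiM
      split_ifs at hiM ⊢ <;> exact hiM
    obtain ⟨δ, hδ, hball⟩ := Metric.mem_nhdsWithin_iff.1 <|
      (hcont _ hend).eventually (gt_mem_nhds hlt)
    exact ⟨δ, hδ, fun x hx hxδ => hball ⟨hxδ, hx⟩⟩
  filter_upwards [Ioo_mem_nhdsGT hδ, Ioo_mem_nhdsGT (sub_pos.2 hM)] with r ⟨hr, hrδ⟩ ⟨_, hrM⟩ e x hx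
  have hzx := abs_le.1 (hz.2 e x hx)
  by_cases he : e = i.1
  · subst he
    have hlt := hclose x hx
    rw [abs_lt] at hlt
    simp only [arcField, nearEnd, if_true, mem_Icc] at hx ⊢
    rw [abs_le]
    split_ifs at hlt ⊢ <;> grind
  · simpa [arcField, he] using hz.2 e x hx

theorem IsCalibration.eventually_integral_nearEnd_le [Finite V] (h : Γ.IsCalibration u z dz)
    (hu : Γ.IsLInfty u) (hij : i ≠ j) (hv : Γ.endVertex i = Γ.endVertex j)
    (hi : Γ.endFlux z i < 1) (hj : -1 < Γ.endFlux z j) :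
    ∀ᶠ r in 𝓝[>] 0, ∫ x in (Γ.nearEnd i r).1..(Γ.nearEnd i r).2, u i.1 x ≤
      ∫ x in (Γ.nearEnd j r).1..(Γ.nearEnd j r).2, u j.1 x := by
  have hedge : i.1 ≠ j.1 := by
    obtain ⟨e, _ | _⟩ := i <;> obtain ⟨e', _ | _⟩ := j <;> rintro rfl
    exacts [hij rfl, Γ.no_loops _ hv, Γ.no_loops _ hv.symm, hij rfl]
  have hj' : Γ.endFlux (fun e x => -z e x) j < 1 := by
    obtain ⟨e, _ | _⟩ := j <;> simp only [endFlux] at hj ⊢ <;> grind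
  filter_upwards [Ioo_mem_nhdsGT (Γ.len_pos i.1), Ioo_mem_nhdsGT (Γ.len_pos j.1),
    h.isAdmissible.eventually_abs_add_arcField_le hi,
    h.isAdmissible.neg.eventually_abs_add_arcField_le hj'] with r ⟨hr, hri⟩ ⟨_, hrj⟩ hzi hzj
  have hnear : ∀ k, r < Γ.len k.1 → 0 ≤ (Γ.nearEnd k r).1 ∧ (Γ.nearEnd k r).2 ≤ Γ.len k.1 ∧
      (Γ.nearEnd k r).2 - (Γ.nearEnd k r).1 = r := fun k hrk => by
    simp only [nearEnd]
    split_ifs <;> grind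
  obtain ⟨hpi, hqi, hleni⟩ := hnear i hri
  obtain ⟨hpj, hqj, hlenj⟩ := hnear j hrj
  refine h.integral_le_integral hu hpi (by linarith) hqi hpj (by linarith) hqj hv
    (hleni.trans hlenj.symm) fun e x hx => ?_
  have hzi' := abs_le.1 (hzi e x hx)
  have hzj' := abs_le.1 (hzj e x hx)
  rw [abs_le]
  by_cases he : e = i.1
  · have hzero : arcField j (Γ.nearEnd j r).1 (Γ.nearEnd j r).2 e x = 0 := if_neg (he ▸ hedge)
    constructor <;> linarith
  · have hzero : arcField i (Γ.nearEnd i r).1 (Γ.nearEnd i r).2 e x = 0 := if_neg he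
    constructor <;> linarith

end Exchange

end MetricGraph

section FirstExit

theorem forall_lt_of_continuousOn_uIcc {f : ℝ → ℝ} {x t M : ℝ} (hf : ContinuousOn f (uIcc x t))
    (h : ∀ s ∈ uIcc x t, (∀ r ∈ uIcc x s, r ≠ s → f r < M) → f s < M) :
    ∀ s ∈ uIcc x t, f s < M := by
  by_contra! ⟨s₀, hs₀, hM⟩
  have hcompact : IsCompact (uIcc x t ∩ f ⁻¹' Ici M) :=
    isCompact_uIcc.of_isClosed_subset (hf.preimage_isClosed_of_isClosed isClosed_Icc isClosed_Ici)
      inter_subset_left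
  obtain ⟨s, ⟨hs, hMs⟩, hmin⟩ := hcompact.exists_isMinOn ⟨s₀, hs₀, hM⟩
    (f := fun s => |s - x|) (by fun_prop)
  refine (h s hs fun r hr hrs => ?_).not_ge hMs
  by_contra! hMr
  have hle : |s - x| ≤ |r - x| := hmin ⟨uIcc_subset_uIcc_left hs hr, hMr⟩
  refine hrs ?_
  rw [mem_uIcc] at hr
  grind

/-- The point `x` is a differentiability point of the primitive of `f`, with derivative `f x`. It
plays the role of a Lebesgue point: almost every point is one. -/
def IsDensityPoint (f : ℝ → ℝ) (x : ℝ) : Prop := HasDerivAt (fun t => ∫ s in 0..t, f s) (f x) x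

theorem ae_isDensityPoint {f : ℝ → ℝ} {L : ℝ} (hf : IntegrableOn f (Ioo 0 L)) :
    ∀ᵐ x ∂volume.restrict (Ioo 0 L), IsDensityPoint f x := by
  rcases le_or_gt L 0 with hL | hL
  · simp [Ioo_eq_empty_of_le hL]
  have hint := intervalIntegrable_of_integrableOn_Ioo hf (left_mem_Icc.2 hL.le)
    (right_mem_Icc.2 hL.le)
  filter_upwards [ae_restrict_mem measurableSet_Ioo, ae_restrict_of_ae hint.ae_hasDerivAt_integral]
    with x hx hderiv
  exact hderiv (Icc_subset_uIcc (Ioo_subset_Icc_self hx)) 0 left_mem_uIcc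

end FirstExit

section Decompositions

/-- The set `D` is, up to a null set, the disjoint union of finitely many intervals in `(0, L)`,
given by their ends, and `z` enters `D` at the value `-1` and leaves it at the value `1`, except at
the ends of `(0, L)`. -/
structure IsBandDecomposition (L : ℝ) (D : Set ℝ) (z : ℝ → ℝ) (parts : Finset (ℝ × ℝ)) :
    Prop where
  nonneg : ∀ p ∈ parts, 0 ≤ p.1
  lt : ∀ p ∈ parts, p.1 < p.2
  le : ∀ p ∈ parts, p.2 ≤ L
  pairwiseDisjoint : (parts : Set (ℝ × ℝ)).PairwiseDisjoint fun p => Ioo p.1 p.2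
  ae_mem_iff : ∀ᵐ x ∂volume.restrict (Ioo 0 L), x ∈ D ↔ ∃ p ∈ parts, x ∈ Ioo p.1 p.2
  left : ∀ p ∈ parts, p.1 = 0 ∨ z p.1 = -1
  right : ∀ p ∈ parts, p.2 = L ∨ z p.2 = 1

end Decompositions

namespace MetricGraph

section Bands

variable {V E : Type*} {Γ : MetricGraph V E} {u z : E → ℝ → ℝ} {e : E} {c m x : ℝ}

/-- The ends of the part of the interval `(0, L)` where the affine function with slope `c` and zero
`m` has absolute value less than one. -/
def band (L c m : ℝ) : ℝ × ℝ := (max 0 (m - 1 / c), min L (m + 1 / c))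

theorem mem_Ioo_band_iff {L : ℝ} (hc : 0 < c) :
    x ∈ Ioo (band L c m).1 (band L c m).2 ↔ x ∈ Ioo 0 L ∧ |c * (x - m)| < 1 := by
  rw [abs_mul, abs_of_pos hc, mul_comm, ← lt_div_iff₀ hc, abs_lt]
  simp only [band, mem_Ioo, max_lt_iff, lt_min_iff]
  grind

variable (Γ) in
/-- The number `m` is the zero of the affine function with slope `c` that coincides with `z` at some
density point of `u` in the edge `e` where `u` is positive and `|z| < 1`. -/
def IsBandCenter (u z : E → ℝ → ℝ) (c : ℝ) (e : E) (m : ℝ) : Prop :=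
  ∃ x ∈ Γ.edge e, IsDensityPoint (u e) x ∧ 0 < u e x ∧ |z e x| < 1 ∧ z e x = c * (x - m)

theorem IsBandCenter.mem_Ioo (hc : 0 < c) (hm : Γ.IsBandCenter u z c e m) :
    m ∈ Ioo (-(1 / c)) (Γ.len e + 1 / c) := by
  obtain ⟨x, hx, -, -, hlt, hzx⟩ := hm
  obtain ⟨hx0, hxL⟩ := (mem_Ioo_band_iff hc).2 ⟨hx, hzx ▸ hlt⟩
  simp only [band, max_lt_iff, lt_min_iff] at hx0 hxL
  constructor <;> linarith

end Bands

section Components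

variable {V E : Type*} [Fintype E] {Γ : MetricGraph V E} {u z dz ξ : E → ℝ → ℝ} {e : E}
  {c m x t : ℝ}

theorem IsAdmissible.abs_lt_one_of_isDensityPoint (hz : Γ.IsAdmissible z dz) (hx : x ∈ Γ.edge e)
    (hdense : IsDensityPoint (dz e) x) (hne : dz e x ≠ 0) : |z e x| < 1 := by
  have hnhds : Γ.edge e ∈ nhds x := isOpen_Ioo.mem_nhds hx
  have hderiv : HasDerivAt (z e) (dz e x) x :=
    (hdense.const_add (z e 0)).congr_of_eventuallyEq <| by
      filter_upwards [hnhds] with s hs using hz.1.eq_add_integral e (Ioo_subset_Icc_self hs)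
  have hbdd : ∀ᶠ s in nhds x, |z e s| ≤ 1 := by
    filter_upwards [hnhds] with s hs using hz.2 e s (Ioo_subset_Icc_self hs)
  refine abs_lt.2 ⟨?_, ?_⟩ <;> refine lt_of_not_ge fun hge => hne ?_
  · refine IsLocalMin.hasDerivAt_eq_zero (hbdd.mono fun s hs => ?_) hderiv
    exact hge.trans (abs_le.1 hs).1
  · refine IsLocalMax.hasDerivAt_eq_zero (hbdd.mono fun s hs => ?_) hderiv
    exact (abs_le.1 hs).2.trans hge

theorem eq_one_of_mem_signSet {a s : ℝ} (ha : 0 < a) (hs : s ∈ signSet a) : s = 1 := by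
  simpa [signSet, ha] using hs

variable (Γ) in
/-- The field `z` calibrates `u` and its derivative is `c` times a sign `ξ` of `u`. -/
structure IsSignCalibration (u z ξ : E → ℝ → ℝ) (c : ℝ) : Prop
    extends Γ.IsCalibration u z fun e x => c * ξ e x where
  isLInfty : Γ.IsLInfty u
  pos : 0 < c
  sign : ∀ e, ∀ x ∈ Γ.edge e, ξ e x ∈ signSet (u e x)

theorem IsSignCalibration.ae_exists_isBandCenter (h : Γ.IsSignCalibration u z ξ c)
    (e : E) : ∀ᵐ x ∂volume.restrict (Γ.edge e), 0 < u e x →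
      ∃ m, Γ.IsBandCenter u z c e m ∧ x ∈ Ioo (band (Γ.len e) c m).1 (band (Γ.len e) c m).2 := by
  filter_upwards [ae_restrict_mem (Γ.measurableSet_edge e),
    ae_isDensityPoint (h.isLInfty.isL2.isL1 e),
    ae_isDensityPoint (h.isAdmissible.1.isL2_deriv.isL1 e)] with x hx hdense hdense' hpos
  have hlt : |z e x| < 1 := h.isAdmissible.abs_lt_one_of_isDensityPoint hx hdense' <| by
    rw [eq_one_of_mem_signSet hpos (h.sign e x hx), mul_one]
    exact h.pos.ne'
  have hzx : z e x = c * (x - (x - z e x / c)) := by have := h.pos.ne'; field_simp; ring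
  exact ⟨x - z e x / c, ⟨x, hx, hdense, hpos, hlt, hzx⟩, (mem_Ioo_band_iff h.pos).2 ⟨hx, hzx ▸ hlt⟩⟩

variable [Finite V]

theorem IsCalibration.ae_eq_of_abs_lt_one (h : Γ.IsCalibration u z dz) (hu : Γ.IsLInfty u)
    (hx : x ∈ Γ.edge e) (hdense : IsDensityPoint (u e) x) :
    ∀ᵐ s ∂volume.restrict (Γ.edge e), (∀ r ∈ uIcc x s, |z e r| < 1) → u e s = u e x := by
  filter_upwards [ae_restrict_mem (Γ.measurableSet_edge e), ae_isDensityPoint (hu.isL2.isL1 e)]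
    with s hs hdense' hlt
  exact (h.eq_of_hasDerivAt hu (Ioo_subset_Icc_self hx) (Ioo_subset_Icc_self hs) hlt hdense
    hdense').symm

/-- As long as `|z| < 1`, the function `u` keeps its positive value and `z` its slope `c`. -/
theorem IsSignCalibration.sub_eq_mul_sub (h : Γ.IsSignCalibration u z ξ c)
    (hx : x ∈ Γ.edge e) (hdense : IsDensityPoint (u e) x) (hpos : 0 < u e x)
    (ht : t ∈ Icc 0 (Γ.len e)) (hlt : ∀ s ∈ uIcc x t, s ≠ t → |z e s| < 1) :
    z e t - z e x = c * (t - x) := by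
  have hx' := Ioo_subset_Icc_self hx
  have hae : ∀ᵐ s ∂volume.restrict (Γ.edge e), s ∈ uIcc x t → ξ e s = 1 := by
    filter_upwards [ae_restrict_mem (Γ.measurableSet_edge e),
      h.ae_eq_of_abs_lt_one h.isLInfty hx hdense, Measure.ae_ne _ t]
      with s hs heq hne hst
    refine eq_one_of_mem_signSet ?_ (h.sign e s hs)
    rwa [heq fun r hr => hlt r (uIcc_subset_uIcc_left hst hr) ?_]
    rintro rfl
    rw [mem_uIcc] at hr hst
    grind
  have hsub : uIoc x t ⊆ Icc 0 (Γ.len e) :=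
    uIoc_subset_uIcc.trans (uIcc_subset_Icc hx' ht)
  have hone : ∀ᵐ s ∂volume.restrict (uIoc x t), ξ e s = 1 := by
    filter_upwards [ae_restrict_mem measurableSet_uIoc,
      ae_restrict_of_ae_restrict_of_subset hsub ((ae_restrict_congr_set Ioo_ae_eq_Icc).1 hae)]
      with s hs hs' using hs' (uIoc_subset_uIcc hs)
  rw [h.isAdmissible.1.sub_eq_integral e hx' ht, intervalIntegral.integral_const_mul,
    intervalIntegral.integral_congr_ae_restrict (g := 1) hone]
  simp

theorem IsSignCalibration.abs_lt_one_of_mem_band (h : Γ.IsSignCalibration u z ξ c)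
    (hx : x ∈ Γ.edge e) (hdense : IsDensityPoint (u e) x) (hpos : 0 < u e x)
    (hlt : |z e x| < 1) (hm : z e x = c * (x - m))
    (ht : t ∈ Ioo (band (Γ.len e) c m).1 (band (Γ.len e) c m).2) :
    ∀ s ∈ uIcc x t, |z e s| < 1 := by
  have hxband : x ∈ Ioo (band (Γ.len e) c m).1 (band (Γ.len e) c m).2 :=
    (mem_Ioo_band_iff h.pos).2 ⟨hx, hm ▸ hlt⟩
  have hband : ∀ s ∈ uIcc x t, s ∈ Γ.edge e ∧ |c * (s - m)| < 1 := fun s hs =>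
    (mem_Ioo_band_iff h.pos).1 (ordConnected_Ioo.uIcc_subset hxband ht hs)
  refine forall_lt_of_continuousOn_uIcc (f := fun s => |z e s|)
    ((h.isAdmissible.1.continuousOn e).mono fun s hs =>
      Ioo_subset_Icc_self (hband s hs).1).abs fun s hs hlt => ?_
  have hsub := h.sub_eq_mul_sub hx hdense hpos (Ioo_subset_Icc_self (hband s hs).1) hlt
  rw [show z e s = c * (s - m) by linarith]
  exact (hband s hs).2

theorem IsBandCenter.eq_mul_sub (h : Γ.IsSignCalibration u z ξ c)
    (hm : Γ.IsBandCenter u z c e m)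
    (ht : t ∈ Icc (band (Γ.len e) c m).1 (band (Γ.len e) c m).2) : z e t = c * (t - m) := by
  obtain ⟨x, hx, hdense, hpos, hlt, hzx⟩ := hm
  have hxband := (mem_Ioo_band_iff h.pos).2 ⟨hx, hzx ▸ hlt⟩
  have hsub := h.sub_eq_mul_sub hx hdense hpos (t := t)
    ⟨(le_max_left _ _).trans ht.1, ht.2.trans (min_le_left _ _)⟩ fun s hs hst =>
      h.abs_lt_one_of_mem_band hx hdense hpos hlt hzx
        (t := s) (by rw [mem_uIcc] at hs; grind) s right_mem_uIcc
  linarith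

theorem IsBandCenter.ae_pos (h : Γ.IsSignCalibration u z ξ c)
    (hm : Γ.IsBandCenter u z c e m) : ∀ᵐ s ∂volume.restrict (Γ.edge e),
      s ∈ Ioo (band (Γ.len e) c m).1 (band (Γ.len e) c m).2 → 0 < u e s := by
  obtain ⟨x, hx, hdense, hpos, hlt, hzx⟩ := hm
  filter_upwards [h.ae_eq_of_abs_lt_one h.isLInfty hx hdense] with s hs hsband
  rwa [hs (h.abs_lt_one_of_mem_band hx hdense hpos hlt hzx hsband)]

theorem IsBandCenter.eq_of_mem (h : Γ.IsSignCalibration u z ξ c) {m' : ℝ}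
    (hm : Γ.IsBandCenter u z c e m) (hm' : Γ.IsBandCenter u z c e m')
    (ht : t ∈ Ioo (band (Γ.len e) c m).1 (band (Γ.len e) c m).2)
    (ht' : t ∈ Ioo (band (Γ.len e) c m').1 (band (Γ.len e) c m').2) : m = m' := by
  have heq := (hm.eq_mul_sub h (Ioo_subset_Icc_self ht)).symm.trans
    (hm'.eq_mul_sub h (Ioo_subset_Icc_self ht'))
  linarith [mul_left_cancel₀ h.pos.ne' heq]

/-- Two bands of length `2 / c` cannot overlap, so their centers are separated. -/
theorem IsSignCalibration.finite_isBandCenter (h : Γ.IsSignCalibration u z ξ c) (e : E) :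
    {m | Γ.IsBandCenter u z c e m}.Finite := by
  have hc := h.pos
  have hscale : ∀ {a b : ℝ}, a ≤ b → ⌊a * (c / 2)⌋ ≤ ⌊b * (c / 2)⌋ := fun hab =>
    Int.floor_mono (mul_le_mul_of_nonneg_right hab (by positivity))
  refine Finite.of_injOn (f := fun m => ⌊m * (c / 2)⌋)
    (t := Icc ⌊-(1 / c) * (c / 2)⌋ ⌊(Γ.len e + 1 / c) * (c / 2)⌋)
    (fun m hm => ⟨hscale (hm.mem_Ioo hc).1.le, hscale (hm.mem_Ioo hc).2.le⟩)
    (fun m hm m' hm' heq => ?_) (finite_Icc _ _)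
  have hclose := Int.abs_sub_lt_one_of_floor_eq_floor heq
  rw [← sub_mul, abs_mul, abs_of_pos (half_pos hc), ← lt_div_iff₀ (half_pos hc), one_div_div,
    ← mul_one_div, abs_lt] at hclose
  obtain ⟨hm0, hmL⟩ := hm.mem_Ioo hc
  obtain ⟨hm0', hmL'⟩ := hm'.mem_Ioo hc
  obtain ⟨t, ht, ht'⟩ : ∃ t, max 0 (max (m - 1 / c) (m' - 1 / c)) < t ∧
      t < min (Γ.len e) (min (m + 1 / c) (m' + 1 / c)) := by
    refine exists_between ?_
    have := Γ.len_pos e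
    simp only [max_lt_iff, lt_min_iff]
    grind
  simp only [max_lt_iff, lt_min_iff] at ht ht'
  refine hm.eq_of_mem (t := t) h hm' ?_ ?_ <;> simp only [band, mem_Ioo, max_lt_iff, lt_min_iff] <;>
    grind

theorem IsSignCalibration.exists_isBandDecomposition (h : Γ.IsSignCalibration u z ξ c) (e : E) :
    ∃ parts, IsBandDecomposition (Γ.len e) (Γ.superlevel u 0 e) (z e) parts := by
  have hlt : ∀ m, Γ.IsBandCenter u z c e m →
      (band (Γ.len e) c m).1 < (band (Γ.len e) c m).2 := fun m ⟨x, hx, _, _, hlt, hzx⟩ =>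
    nonempty_Ioo.1 ⟨x, (mem_Ioo_band_iff h.pos).2 ⟨hx, hzx ▸ hlt⟩⟩
  have hfin := h.finite_isBandCenter e
  refine ⟨hfin.toFinset.image (band (Γ.len e) c), ?_, ?_, ?_, ?_, ?_, ?_, ?_⟩ <;>
    simp only [Finset.forall_mem_image, Finset.exists_mem_image, Finset.coe_image,
      Finite.mem_toFinset, Finite.coe_toFinset, mem_ofPred_eq]
  · exact fun m _ => le_max_left _ _
  · exact hlt
  · exact fun m _ => min_le_left _ _
  · rintro _ ⟨m, hm, rfl⟩ _ ⟨m', hm', rfl⟩ hne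
    refine disjoint_left.2 fun x hx hx' => hne ?_
    rw [hm.eq_of_mem h hm' hx hx']
  · have hpos := (ae_ball_iff hfin.countable).2 fun m (hm : Γ.IsBandCenter u z c e m) => hm.ae_pos h
    filter_upwards [ae_restrict_mem (Γ.measurableSet_edge e), hpos, h.ae_exists_isBandCenter e]
      with x hx hpos hband
    exact ⟨fun hxD => hband hxD.2, fun ⟨m, hm, hxm⟩ => ⟨hx, hpos m hm hxm⟩⟩
  · refine fun m hm => (max_choice 0 (m - 1 / c)).imp_right fun hleft => ?_
    rw [hm.eq_mul_sub h (left_mem_Icc.2 (hlt m hm).le)]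
    simp only [band, hleft]
    have := h.pos.ne'
    field_simp
    ring
  · refine fun m hm => (min_choice (Γ.len e) (m + 1 / c)).imp_right fun hright => ?_
    rw [hm.eq_mul_sub h (right_mem_Icc.2 (hlt m hm).le)]
    simp only [band, hright]
    have := h.pos.ne'
    field_simp
    ring

end Components

end MetricGraph

section Decompositions

variable {L : ℝ} {D : Set ℝ} {z w : ℝ → ℝ} {parts : Finset (ℝ × ℝ)}

theorem sum_le_ite_of_subsingleton {ι : Type*} {s : Finset ι} {P : ι → Prop} {a : ι → ℝ} {b : ℝ}
    [Decidable (∃ i ∈ s, P i)] (huniq : ∀ i ∈ s, ∀ j ∈ s, P i → P j → i = j)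
    (hP : ∀ i ∈ s, P i → a i = b) (hnot : ∀ i ∈ s, ¬P i → a i ≤ 0) :
    ∑ i ∈ s, a i ≤ if ∃ i ∈ s, P i then b else 0 := by
  classical
  split_ifs with hex
  · obtain ⟨i, hi, hPi⟩ := hex
    rw [← Finset.add_sum_erase s a hi, hP i hi hPi, add_le_iff_nonpos_right]
    refine Finset.sum_nonpos fun j hj => hnot j (Finset.mem_of_mem_erase hj) fun hPj => ?_
    exact Finset.ne_of_mem_erase hj (huniq j (Finset.mem_of_mem_erase hj) i hi hPj hPi)
  · exact Finset.sum_nonpos fun i hi => hnot i hi fun hPi => hex ⟨i, hi, hPi⟩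

namespace IsBandDecomposition

theorem eq_of_mem (h : IsBandDecomposition L D z parts) {p q : ℝ × ℝ} (hp : p ∈ parts)
    (hq : q ∈ parts) {x : ℝ} (hxp : x ∈ Ioo p.1 p.2) (hxq : x ∈ Ioo q.1 q.2) : p = q :=
  h.pairwiseDisjoint.elim hp hq (not_disjoint_iff.2 ⟨x, hxp, hxq⟩)

theorem indicator_ae_eq (h : IsBandDecomposition L D z parts) :
    (fun x => ∑ p ∈ parts, (Ioo p.1 p.2).indicator 1 x) =ᵐ[volume.restrict (Ioo 0 L)]
      D.indicator (1 : ℝ → ℝ) := by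
  filter_upwards [h.ae_mem_iff] with x hx
  rw [← Finset.indicator_biUnion_apply _ _ h.pairwiseDisjoint]
  simp only [indicator, mem_iUnion, exists_prop, hx]

theorem isBVOn_indicator (h : IsBandDecomposition L D z parts) : IsBVOn 0 L (D.indicator 1) :=
  (IsBVOn.sum parts fun p hp =>
    IsBVOn.indicator_Ioo (h.nonneg p hp) (h.lt p hp).le (h.le p hp)).congr_ae h.indicator_ae_eq

theorem setIntegral_indicator_mul (h : IsBandDecomposition L D z parts) {f : ℝ → ℝ}
    (hf : IntegrableOn f (Ioo 0 L)) : ∫ x in Ioo 0 L, D.indicator 1 x * f x =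
      ∑ p ∈ parts, ∫ x in p.1..p.2, f x := by
  calc ∫ x in Ioo 0 L, D.indicator 1 x * f x
      = ∫ x in Ioo 0 L, ∑ p ∈ parts, (Ioo p.1 p.2).indicator f x := by
        refine integral_congr_ae ?_
        filter_upwards [h.indicator_ae_eq] with x hx
        rw [← hx, Finset.sum_mul]
        refine Finset.sum_congr rfl fun p _ => ?_
        by_cases hxp : x ∈ Ioo p.1 p.2 <;> simp [hxp]
    _ = ∑ p ∈ parts, ∫ x in Ioo 0 L, (Ioo p.1 p.2).indicator f x :=
        integral_finsetSum _ fun p _ => hf.indicator measurableSet_Ioo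
    _ = ∑ p ∈ parts, ∫ x in p.1..p.2, f x := Finset.sum_congr rfl fun p hp => by
        rw [setIntegral_indicator measurableSet_Ioo,
          inter_eq_right.2 (Ioo_subset_Ioo (h.nonneg p hp) (h.le p hp)),
          setIntegral_Ioo_eq_intervalIntegral (h.lt p hp).le]

open Classical in
/-- Inside `(0, L)` the values of `w` cannot exceed those of `z` at the right ends of the parts, nor
be smaller at the left ends. -/
theorem sum_sub_le (h : IsBandDecomposition L D z parts) (hw : ∀ x ∈ Icc 0 L, |w x| ≤ 1) :
    ∑ p ∈ parts, ((w p.2 - z p.2) - (w p.1 - z p.1)) ≤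
      (if ∃ p ∈ parts, p.2 = L then w L - z L else 0) +
        if ∃ p ∈ parts, p.1 = 0 then -w 0 - -z 0 else 0 := by
  have hbound : ∀ p ∈ parts, |w p.1| ≤ 1 ∧ |w p.2| ≤ 1 := fun p hp =>
    ⟨hw _ ⟨h.nonneg p hp, (h.lt p hp).le.trans (h.le p hp)⟩,
      hw _ ⟨(h.nonneg p hp).trans (h.lt p hp).le, h.le p hp⟩⟩
  simp only [abs_le] at hbound
  simp only [sub_eq_add_neg (_ - _) (_ - _), Finset.sum_add_distrib]
  refine add_le_add (sum_le_ite_of_subsingleton (P := fun p : ℝ × ℝ => p.2 = L) ?_ ?_ ?_)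
    (sum_le_ite_of_subsingleton (P := fun p : ℝ × ℝ => p.1 = 0) ?_ ?_ ?_)
  · intro p hp q hq hpL hqL
    obtain ⟨x, hx, hxL⟩ := exists_between (max_lt (hpL ▸ h.lt p hp) (hqL ▸ h.lt q hq))
    rw [max_lt_iff] at hx
    exact h.eq_of_mem hp hq ⟨hx.1, hpL ▸ hxL⟩ ⟨hx.2, hqL ▸ hxL⟩
  · exact fun p _ hpL => by rw [hpL]
  · intro p hp hpL
    linarith [(hbound p hp).2.2, (h.right p hp).resolve_left hpL]
  · intro p hp q hq hp0 hq0
    obtain ⟨x, hx0, hx⟩ := exists_between (lt_min (hp0 ▸ h.lt p hp) (hq0 ▸ h.lt q hq))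
    rw [lt_min_iff] at hx
    exact h.eq_of_mem hp hq ⟨hp0 ▸ hx0, hx.1⟩ ⟨hq0 ▸ hx0, hx.2⟩
  · exact fun p _ hp0 => by rw [hp0]; ring
  · intro p hp hp0
    linarith [(hbound p hp).1.1, (h.left p hp).resolve_left hp0]

end IsBandDecomposition

end Decompositions

namespace MetricGraph

section Vertices

open scoped Topology

variable {V E : Type*} {Γ : MetricGraph V E} {u z ξ w dw : E → ℝ → ℝ} {c : ℝ} {i j : E × Bool}
  {D : E → Set ℝ} {parts : E → Finset (ℝ × ℝ)}

variable (Γ) in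
/-- One of the intervals in the edge `i.1` reaches the end `i` of this edge. -/
def IsTouched (parts : E → Finset (ℝ × ℝ)) (i : E × Bool) : Prop :=
  if i.2 then ∃ p ∈ parts i.1, p.2 = Γ.len i.1 else ∃ p ∈ parts i.1, p.1 = 0

theorem eventually_mem_part_iff_isTouched
    (h : ∀ e, IsBandDecomposition (Γ.len e) (D e) (z e) (parts e)) (i : E × Bool) :
    ∀ᶠ r in 𝓝[>] 0, ∀ x ∈ Ioo (Γ.nearEnd i r).1 (Γ.nearEnd i r).2,
      (∃ p ∈ parts i.1, x ∈ Ioo p.1 p.2) ↔ Γ.IsTouched parts i := by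
  have hsmall : ∀ {a : ℝ}, 0 ≤ a → ∀ᶠ r in 𝓝[>] 0, a = 0 ∨ r < a := fun ha =>
    ha.eq_or_lt.elim (fun ha => .of_forall fun _ => .inl ha.symm) fun ha => by
      filter_upwards [Ioo_mem_nhdsGT ha] with r hr using .inr hr.2
  have hgap : ∀ᶠ r in 𝓝[>] 0, ∀ p ∈ parts i.1, (p.1 = 0 ∨ r < p.1) ∧
      (Γ.len i.1 - p.2 = 0 ∨ r < Γ.len i.1 - p.2) ∧ r < p.2 - p.1 := by
    refine (Filter.eventually_all_finset _).2 fun p hp => ?_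
    filter_upwards [hsmall ((h i.1).nonneg p hp), hsmall (sub_nonneg.2 ((h i.1).le p hp)),
      Ioo_mem_nhdsGT (sub_pos.2 ((h i.1).lt p hp))] with r hr hr' hr'' using ⟨hr, hr', hr''.2⟩
  filter_upwards [hgap] with r hr x hx
  obtain ⟨e, _ | _⟩ := i <;> simp only [nearEnd, IsTouched, if_true, Bool.false_eq_true, if_false,
    mem_Ioo] at hr hx ⊢ <;> refine exists_congr fun p => and_congr_right fun hp => ?_ <;>
    have := hr p hp <;> have := (h e).nonneg p hp <;> have := (h e).le p hp <;> grind

theorem IsSignCalibration.eventually_integral_nearEnd_pos_iff [Fintype E]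
    (h : Γ.IsSignCalibration u z ξ c)
    (hparts : ∀ e, IsBandDecomposition (Γ.len e) (Γ.superlevel u 0 e) (z e) (parts e))
    (i : E × Bool) : ∀ᶠ r in 𝓝[>] 0,
      0 < ∫ x in (Γ.nearEnd i r).1..(Γ.nearEnd i r).2, u i.1 x ↔ Γ.IsTouched parts i := by
  filter_upwards [eventually_mem_part_iff_isTouched hparts i, Ioo_mem_nhdsGT (Γ.len_pos i.1)]
    with r hmem ⟨hr, hrlen⟩
  have hlt : (Γ.nearEnd i r).1 < (Γ.nearEnd i r).2 := by
    simp only [nearEnd]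
    split_ifs <;> simpa using hr
  have hsub : Ioo (Γ.nearEnd i r).1 (Γ.nearEnd i r).2 ⊆ Γ.edge i.1 := by
    simp only [nearEnd]
    split_ifs <;> refine Ioo_subset_Ioo ?_ ?_ <;> linarith
  have hpos : ∀ᵐ x ∂volume.restrict (Ioo (Γ.nearEnd i r).1 (Γ.nearEnd i r).2),
      0 < u i.1 x ↔ Γ.IsTouched parts i := by
    filter_upwards [ae_restrict_mem measurableSet_Ioo,
      ae_restrict_of_ae_restrict_of_subset hsub (hparts i.1).ae_mem_iff] with x hx hxD
    rw [← hmem x hx, ← hxD]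
    exact ⟨fun hux => ⟨hsub hx, hux⟩, And.right⟩
  rw [← setIntegral_Ioo_eq_intervalIntegral hlt.le]
  by_cases hi : Γ.IsTouched parts i
  · simp only [hi, iff_true] at hpos ⊢
    rw [integral_pos_iff_support_of_nonneg_ae (hpos.mono fun x hx => hx.le)
      ((h.isLInfty.isL2.isL1 i.1).mono_set hsub)]
    have hsupp : Function.support (u i.1) =ᵐ[volume.restrict
        (Ioo (Γ.nearEnd i r).1 (Γ.nearEnd i r).2)] univ :=
      Filter.eventuallyEq_univ.2 (hpos.mono fun x hx => hx.ne')
    rw [measure_congr hsupp]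
    simpa using hlt
  · simp only [hi, iff_false, not_lt] at hpos ⊢
    exact integral_nonpos_of_ae hpos

theorem IsAdmissible.abs_endFlux_le [Fintype E] (hz : Γ.IsAdmissible z dz) (i : E × Bool) :
    |Γ.endFlux z i| ≤ 1 := by
  simp only [endFlux]
  split_ifs
  · exact hz.2 _ _ (right_mem_Icc.2 (Γ.len_pos _).le)
  · exact (abs_neg _).trans_le (hz.2 _ _ (left_mem_Icc.2 (Γ.len_pos _).le))

theorem IsSignCalibration.endFlux_eq_one_or_eq_neg_one [Finite V] [Fintype E]
    (h : Γ.IsSignCalibration u z ξ c)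
    (hparts : ∀ e, IsBandDecomposition (Γ.len e) (Γ.superlevel u 0 e) (z e) (parts e))
    (hv : Γ.endVertex i = Γ.endVertex j) (hi : Γ.IsTouched parts i) (hj : ¬Γ.IsTouched parts j) :
    Γ.endFlux z i = 1 ∨ Γ.endFlux z j = -1 := by
  by_contra! ⟨hi1, hj1⟩
  have hij : i ≠ j := fun hij => hj (hij ▸ hi)
  obtain ⟨r, hle, hri, hrj⟩ := ((h.eventually_integral_nearEnd_le h.isLInfty hij hv
    ((abs_le.1 (h.isAdmissible.abs_endFlux_le i)).2.lt_of_ne hi1)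
    ((abs_le.1 (h.isAdmissible.abs_endFlux_le j)).1.lt_of_ne' hj1)).and
    ((h.eventually_integral_nearEnd_pos_iff hparts i).and
      (h.eventually_integral_nearEnd_pos_iff hparts j))).exists
  exact hj (hrj.1 ((hri.2 hi).trans_le hle))

end Vertices

section Superlevel

variable {V E : Type*} [Fintype E] {Γ : MetricGraph V E} {u z ξ w dw : E → ℝ → ℝ} {c : ℝ}
  {D : E → Set ℝ} {parts : E → Finset (ℝ × ℝ)}

open Classical in
/-- The sum changes only favorably if `T` is replaced by the set of all indices lying over some
`v i` with `i ∈ T` and `b i ≠ 1`, over which it vanishes by balance. -/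
theorem sum_sub_nonpos_of_balanced {ι : Type*} [Fintype ι] {v : ι → V} {T : ι → Prop}
    {a b : ι → ℝ} (habs : ∀ i, |a i| ≤ 1) (ha : ∀ g : V → ℝ, ∑ i, g (v i) * a i = 0)
    (hb : ∀ g : V → ℝ, ∑ i, g (v i) * b i = 0)
    (hsat : ∀ i j, v i = v j → T i → ¬T j → b i = 1 ∨ b j = -1) :
    ∑ i, (if T i then a i - b i else 0) ≤ 0 := by
  let g : V → ℝ := fun x => if ∃ i, v i = x ∧ T i ∧ b i ≠ 1 then 1 else 0
  calc ∑ i, (if T i then a i - b i else 0) ≤ ∑ i, g (v i) * (a i - b i) := by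
        refine Finset.sum_le_sum fun i _ => ?_
        have := abs_le.1 (habs i)
        simp only [g, ite_mul, one_mul, zero_mul]
        split_ifs with hTi hex hex
        · exact le_rfl
        · linarith [not_not.1 fun hbi => hex ⟨i, rfl, hTi, hbi⟩]
        · obtain ⟨j, hji, hTj, hbj⟩ := hex
          linarith [(hsat j i hji hTj hTi).resolve_left hbj]
        · exact le_rfl
    _ = 0 := by simp only [mul_sub, Finset.sum_sub_distrib, ha, hb, sub_zero]

theorem integral_chi_mul_deriv
    (hparts : ∀ e, IsBandDecomposition (Γ.len e) (D e) (z e) (parts e)) (hw : Γ.IsXK w dw) :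
    Γ.integral (fun e x => chi D e x * dw e x) =
      ∑ e, ∑ p ∈ parts e, (w e p.2 - w e p.1) := by
  refine Finset.sum_congr rfl fun e _ =>
    ((hparts e).setIntegral_indicator_mul (hw.isL2_deriv.isL1 e)).trans
      (Finset.sum_congr rfl fun p hp => ?_)
  have hlt := (hparts e).lt p hp
  have h0 := (hparts e).nonneg p hp
  have hL := (hparts e).le p hp
  rw [hw.sub_eq_integral e ⟨h0, hlt.le.trans hL⟩ ⟨h0.trans hlt.le, hL⟩]

theorem neg_mem_competitors (hu : u ∈ Γ.competitors) : -u ∈ Γ.competitors := by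
  refine ⟨fun e => (hu.1 e).neg, ?_, ?_, ?_⟩
  · simpa only [norm1, Pi.neg_apply, abs_neg] using hu.2.1
  · rw [sublevel_neg_zero]
    exact hu.2.2.2
  · rw [superlevel_neg_zero]
    exact hu.2.2.1

theorem IsMinimizer.neg (hu : Γ.IsMinimizer u) : Γ.IsMinimizer (-u) :=
  ⟨neg_mem_competitors hu.1, by simpa only [TV_neg] using hu.2⟩

variable [Finite V]

/-- The field `z` also calibrates the characteristic function of `{u > 0}`. -/
theorem IsSignCalibration.integral_chi_superlevel_mul_le (h : Γ.IsSignCalibration u z ξ c)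
    (hw : Γ.IsAdmissible w dw) :
    Γ.integral (fun e x => chi (Γ.superlevel u 0) e x * dw e x) ≤
      Γ.integral fun e x => chi (Γ.superlevel u 0) e x * (c * ξ e x) := by
  classical
  choose parts hparts using h.exists_isBandDecomposition
  rw [integral_chi_mul_deriv hparts hw.1, integral_chi_mul_deriv hparts h.isAdmissible.1,
    ← sub_nonpos]
  calc ∑ e, ∑ p ∈ parts e, (w e p.2 - w e p.1) - ∑ e, ∑ p ∈ parts e, (z e p.2 - z e p.1)
      = ∑ e, ∑ p ∈ parts e, ((w e p.2 - z e p.2) - (w e p.1 - z e p.1)) := by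
        simp only [← Finset.sum_sub_distrib, sub_sub_sub_comm]
    _ ≤ ∑ i, if Γ.IsTouched parts i then Γ.endFlux w i - Γ.endFlux z i else 0 := by
        rw [Fintype.sum_prod_type]
        refine Finset.sum_le_sum fun e _ => ((hparts e).sum_sub_le (hw.2 e)).trans_eq ?_
        simp [IsTouched, endFlux]
    _ ≤ 0 := sum_sub_nonpos_of_balanced hw.abs_endFlux_le (isXK_iff.1 hw.1).2
        (isXK_iff.1 h.isAdmissible.1).2 fun _ _ => h.endFlux_eq_one_or_eq_neg_one hparts

theorem IsSignCalibration.finitePerimeter_superlevel (h : Γ.IsSignCalibration u z ξ c) :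
    Γ.FinitePerimeter (Γ.superlevel u 0) := fun e =>
  (h.exists_isBandDecomposition e).elim fun _ hparts => hparts.isBVOn_indicator

theorem IsSignCalibration.per_superlevel_le (h : Γ.IsSignCalibration u z ξ c) :
    Γ.Per (Γ.superlevel u 0) ≤ c * Γ.length (Γ.superlevel u 0) := by
  refine TV_le fun w dw hw => (h.integral_chi_superlevel_mul_le hw).trans_eq ?_
  rw [length_eq_integral_chi h.finitePerimeter_superlevel.isL1, ← integral_const_mul]
  refine congr_arg Γ.integral (funext₂ fun e x => ?_)
  by_cases hx : x ∈ Γ.superlevel u 0 e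
  · simp [chi, hx, eq_one_of_mem_signSet hx.2 (h.sign e x hx.1)]
  · simp [chi, hx]

theorem IsMinimizer.exists_isSignCalibration [Nonempty E] (hu : Γ.IsMinimizer u) :
    ∃ z ξ, Γ.IsSignCalibration u z ξ Γ.cheeger := by
  obtain ⟨ξ, z, hsign, hz, hint⟩ := exists_calibration_of_mem_competitors hu.1
  refine ⟨z, ξ, ⟨hz, fun w dw hw => ?_⟩, hu.1.1.isLInfty, cheeger_pos Γ, hsign⟩
  exact (hu.1.1.integral_mul_le_TV hw).trans (hu.TV_le_cheeger.trans hint.ge)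

theorem IsMinimizer.isCheegerCut_superlevel [Nonempty E] (hu : Γ.IsMinimizer u)
    (hpos : 0 < Γ.length (Γ.superlevel u 0)) : Γ.IsCheegerCut (Γ.superlevel u 0) := by
  obtain ⟨z, ξ, h⟩ := hu.exists_isSignCalibration
  have hle := hu.1.2.2.2
  have hper := h.finitePerimeter_superlevel.mul_length_le_per
    (fun _ => IsBalanced.exists_isAdmissible) hle
  exact ⟨h.finitePerimeter_superlevel, hpos, hle, (eq_div_iff hpos.ne').2 <|
    hper.antisymm h.per_superlevel_le⟩

end Superlevel

end MetricGraph

end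

theorem mainTheorem2 {V E : Type*} [Fintype V] [Fintype E] [Nonempty E] (Γ : MetricGraph V E) :
    Γ.cheeger = sInf {lam : ℝ | lam ≠ 0 ∧ Γ.IsEigenvalue lam} ∧
    IsLeast {lam : ℝ | lam ≠ 0 ∧ Γ.IsEigenvalue lam} Γ.cheeger ∧
    ∀ u : E → ℝ → ℝ, Γ.IsMinimizer u →
      (0 < Γ.length (Γ.superlevel u 0) →
        ∃ t : ℝ, 0 ≤ t ∧ Γ.IsCheegerCut (Γ.superlevel u t) ∧
          Γ.IsEigenpair Γ.cheeger fun e x =>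
            (1 / Γ.length (Γ.superlevel u t)) * MetricGraph.chi (Γ.superlevel u t) e x) ∧
      (0 < Γ.length (Γ.sublevel u 0) →
        ∃ t : ℝ, 0 ≤ t ∧ Γ.IsCheegerCut (Γ.superlevel (-u) t) ∧
          Γ.IsEigenpair Γ.cheeger fun e x =>
            (1 / Γ.length (Γ.superlevel (-u) t)) * MetricGraph.chi (Γ.superlevel (-u) t) e x) := by
  have hleast : IsLeast {lam : ℝ | lam ≠ 0 ∧ Γ.IsEigenvalue lam} Γ.cheeger :=
    MetricGraph.isLeast_cheeger
  refine ⟨hleast.csInf_eq.symm, hleast, fun u hu => ⟨fun hpos => ?_, fun hpos => ?_⟩⟩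
  · have hcut := hu.isCheegerCut_superlevel hpos
    exact ⟨0, le_rfl, hcut, hcut.isEigenpair⟩
  · rw [← MetricGraph.superlevel_neg_zero] at hpos
    have hcut := hu.neg.isCheegerCut_superlevel hpos
    exact ⟨0, le_rfl, hcut, hcut.isEigenpair⟩
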